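/- Let $X$ and $Y$ be real Banach spaces with $X\subset Y$, the embedding being linear, injective and continuous. Let $\psi,\Phi:X\to(-\infty,+\infty]$, put $I=\psi+\Phi$, $D_\psi=\{\psi<+\infty\}$, $D_\Phi=\{\Phi<+\infty\}$, $D_I=D_\psi\cap D_\Phi$, and assume: 1. $D_\Phi$ is open in $X$ and $D_I\neq\emptyset$; 2. $\psi$ is convex and lower semicontinuous, and $\psi$ is continuous on every nonempty compact set $A\subset X$ with $\sup_A\psi<+\infty$; 3. $\Phi$ is locally Lipschitz continuous in $D_\Phi$; 4. if $x_n\in D_I$ and $\operatorname{dist}(x_n,\partial D_\Phi)\to0$, then $I(x_n)\to+\infty$ (with $\operatorname{dist}(\cdot,\emptyset)=+\infty$). For $x\in D_\Phi$ and $u\in X$ let $\Phi^0(x;u)=\limsup_{w\to x,\,t\to0^+}\frac{\Phi(w+tu)-\Phi(w)}{t}$. A point $x\in D_I$ is a critical point of $I$ if $\Phi^0(x;z-x)+\psi(z)-\psi(x)\ge0$ for all $z\in X$, and its level is $I(x)$. A Palais–Smale sequence at level $c\in\mathbb R$ is a sequence $(x_n)$ in $D_I$ with $I(x_n)\to c$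 such that, for some $\epsilon_n\to0^+$, $\Phi^0(x_n;z-x_n)+\psi(z)-\psi(x_n)\ge-\epsilon_n\|z-x_n\|$ for all $n$ and all $z\in X$. Assume that $I$ satisfies the weak Palais–Smale condition at every level $c\in\mathbb{R}$ with $c>\inf I$: every Palais–Smale sequence at level $c$ has a subsequence that converges in the norm of $Y$ to a critical point $x\in X$ of $I$ with $I(x)=c$. For $A\subset D_\Phi$ let $\operatorname{cat}_X(A,D_\Phi)$ be the least integer $k\ge0$ such that $A$ is covered by $k$ closed sets $A_1,\dots,A_k\subset D_\Phi$, each contractible in $D_\Phi$ (its inclusion into $D_\Phi$ is homotopic to a constant map), and $+\infty$ if there is no such $k$. For $j\in\mathbb N$ let $$\mathcal F_j=\{A\subset D_\Phi: A\text{ compact},\ \operatorname{cat}_X(A,D_\Phi)\ge j\},\qquad c_j=\inf_{A\in\mathcal F_j}\sup_{x\in A}I(x).$$ Assume that for some $j_0\in\mathbb N$: (i) $\mathcal F_j\ne\emptyset$ for every $j\ge j_0$; (ii) $c_j<+\infty$ for every $j\ge j_0$; (iii) $c_{j_0}>\inf I$. Then: - (a1) for every $j\ge j_0$, $c_j$ is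 a critical level of $I$, that is, $I$ has a critical point $x$ with $I(x)=c_j$. Suppose moreover that every critical point $x$ of $I$ with $I(x)>\inf I$ has a $Y$-neighbourhood in $D_\Phi$, i.e. $\{u\in X:\|u-x\|_Y<r\}\subset D_\Phi$ for some $r>0$ (for instance, $D_\Phi$ is open in $X$ for the norm of $Y$). Then $I$ has infinitely many critical points, and - (a2) if in addition $D_\Phi$ is connected, then whenever $c_{j_1}=c_{j_2}$ for some $j_2>j_1\ge j_0$, $I$ has infinitely many critical points at level $c_{j_1}$. -/

import Mathlib

open Set Filter Topology

namespace NonsmoothMinMax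

noncomputable section

/-- The effective domain `{x | f x < +∞}` of an extended-real-valued functional. -/
def effDomain {X : Type*} (f : X → EReal) : Set X := {x | f x < ⊤}

/-- The functional `I = ψ + Φ`. -/
def energy {X : Type*} (ψ Φ : X → EReal) (x : X) : EReal := ψ x + Φ x

/-- The structural assumption on `I = ψ + Φ`. Functionals with values in `(-∞, +∞]` are
`EReal`-valued functionals that avoid `⊥`. The distance to the boundary is taken in `[0, ∞]`, so
that it is `∞` (and the last condition is void) when the boundary of `D_Φ` is empty. -/
structure StructuralAssumption {X : Type*} [NormedAddCommGroup X] [NormedSpace ℝ X]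
    (ψ Φ : X → EReal) : Prop where
  psi_ne_bot : ∀ x, ψ x ≠ ⊥
  phi_ne_bot : ∀ x, Φ x ≠ ⊥
  isOpen_domain : IsOpen (effDomain Φ)
  domain_nonempty : (effDomain ψ ∩ effDomain Φ).Nonempty
  psi_convex : ∀ x y : X, ∀ a b : ℝ, 0 ≤ a → 0 ≤ b → a + b = 1 →
    ψ (a • x + b • y) ≤ (a : EReal) * ψ x + (b : EReal) * ψ y
  psi_lsc : LowerSemicontinuous ψ
  psi_continuousOn : ∀ A : Set X, A.Nonempty → IsCompact A → (⨆ x ∈ A, ψ x) < ⊤ →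
    ContinuousOn ψ A
  phi_locallyLipschitz : LocallyLipschitzOn (effDomain Φ) (fun x => (Φ x).toReal)
  blow_up : ∀ x : ℕ → X, (∀ n, x n ∈ effDomain ψ ∩ effDomain Φ) →
    Tendsto (fun n => Metric.infEDist (x n) (frontier (effDomain Φ))) atTop (𝓝 0) →
    Tendsto (fun n => energy ψ Φ (x n)) atTop (𝓝 ⊤)

/-- The generalized directional derivative
`Φ⁰(x; u) = limsup_{w → x, t → 0⁺} (Φ (w + t u) - Φ w) / t`, for `x` in the open set where `Φ` is
finite (there `toReal` is the identity for all `w` close to `x` and all small `t`). -/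
def genDeriv {X : Type*} [NormedAddCommGroup X] [NormedSpace ℝ X]
    (Φ : X → EReal) (x u : X) : EReal :=
  limsup (fun p : X × ℝ =>
    ((((Φ (p.1 + p.2 • u)).toReal - (Φ p.1).toReal) / p.2 : ℝ) : EReal)) (𝓝 x ×ˢ 𝓝[>] (0 : ℝ))

/-- Critical points of `I = ψ + Φ`. -/
def IsCriticalPoint {X : Type*} [NormedAddCommGroup X] [NormedSpace ℝ X]
    (ψ Φ : X → EReal) (x : X) : Prop :=
  x ∈ effDomain ψ ∩ effDomain Φ ∧ ∀ z : X, 0 ≤ genDeriv Φ x (z - x) + ψ z - ψ x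

/-- Palais–Smale sequences of `I = ψ + Φ` at level `c`. The terms lie in the domain of `I`,
where the quantities in the inequality are defined. -/
def IsPSSequence {X : Type*} [NormedAddCommGroup X] [NormedSpace ℝ X]
    (ψ Φ : X → EReal) (c : ℝ) (x : ℕ → X) : Prop :=
  (∀ n, x n ∈ effDomain ψ ∩ effDomain Φ) ∧
  Tendsto (fun n => energy ψ Φ (x n)) atTop (𝓝 (c : EReal)) ∧
  ∃ ε : ℕ → ℝ, (∀ n, 0 < ε n) ∧ Tendsto ε atTop (𝓝 0) ∧
    ∀ (n : ℕ) (z : X),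
      ((-(ε n * ‖z - x n‖) : ℝ) : EReal) ≤ genDeriv Φ (x n) (z - x n) + ψ z - ψ (x n)

/-- The weak Palais–Smale condition at level `c`, with respect to the embedding `ι : X → Y`. -/
def WeakPS {X Y : Type*} [NormedAddCommGroup X] [NormedSpace ℝ X]
    [NormedAddCommGroup Y] [NormedSpace ℝ Y] (ι : X →L[ℝ] Y) (ψ Φ : X → EReal) (c : ℝ) : Prop :=
  ∀ x : ℕ → X, IsPSSequence ψ Φ c x →
    ∃ (y : X) (k : ℕ → ℕ), StrictMono k ∧ IsCriticalPoint ψ Φ y ∧ energy ψ Φ y = (c : EReal) ∧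
      Tendsto (fun n => ι (x (k n))) atTop (𝓝 (ι y))

/-- `A ⊆ M` is contractible in `M`: the inclusion `A → M` is homotopic in `M` to a constant. -/
def ContractibleIn {X : Type*} [TopologicalSpace X] (A M : Set X) : Prop :=
  ∃ h : A ⊆ M, ContinuousMap.Nullhomotopic (⟨Set.inclusion h, continuous_inclusion h⟩ : C(A, M))

/-- The Lusternik–Schnirelmann category of `A` relative to `M`: the least number of closed
subsets of `M`, contractible in `M`, that cover `A` (`⊤` if there is no such number). -/
def relCat {X : Type*} [TopologicalSpace X] (A M : Set X) : ℕ∞ :=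
  sInf {k : ℕ∞ | ∃ n : ℕ, k = n ∧ ∃ C : Fin n → Set X,
    (∀ i, IsClosed (C i) ∧ ContractibleIn (C i) M) ∧ A ⊆ ⋃ i, C i}

/-- The family `𝓕_j` of compact subsets of `D_Φ` whose category relative to `D_Φ` is at
least `j`. -/
def minMaxFamily {X : Type*} [TopologicalSpace X] (Φ : X → EReal) (j : ℕ) : Set (Set X) :=
  {A | A ⊆ effDomain Φ ∧ IsCompact A ∧ (j : ℕ∞) ≤ relCat A (effDomain Φ)}

/-- The min-max level `c_j = inf_{A ∈ 𝓕_j} sup_A I`. -/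
def minMaxLevel {X : Type*} [TopologicalSpace X] (ψ Φ : X → EReal) (j : ℕ) : EReal :=
  ⨅ A ∈ minMaxFamily Φ j, ⨆ x ∈ A, energy ψ Φ x

end

end NonsmoothMinMax

open NonsmoothMinMax

/-! Everything rests on `not_subset_of_minMaxLevel_eq`: if c_j = c_{j+m} = c, no set of category at
most m contains a uniform Y-neighbourhood U of the critical points at level c. Take A nearly optimal
for c_{j+m}. By subadditivity A \ U still has category at least j. Ekeland's principle for A ↦ sup_A
I, on compact sets of category at least j with the Hausdorff metric, replaces A \ U by a nearby
almost minimal set C. Being close to A \ U, C avoids a smaller Y-neighbourhood, so the weak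
Palais–Smale condition bounds the slope from below at its top points. A deformation then lowers the
supremum faster than Ekeland's inequality allows.

The deformation is u ↦ u + t v(u), with no flow. Where the critical point inequality fails, the
rescaled descent data form a convex set and nearby points share a common choice, so a partition of
unity gives a continuous v. Convexity of ψ and subadditivity of the bounds on Φ make the averaged
directions decrease I. Ekeland's principle needs closed sublevels: these come from the blow-up of I
at the boundary of D_Φ and from the continuity of the category.

Small Y-balls are convex, hence contractible in D_Φ if they lie in it. Taking m = 0 gives (a1);
taking m to be the number of critical points at a level rules out finitely many critical points; m =
1 gives (a2), since in a connected D_Φ finitely many disjoint balls are contractible together. -/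

namespace NonsmoothMinMax

/-! ### Contractible subsets of open sets -/

/-- Maps into `M ⊆ E` joined by segments in `M` are homotopic in `M`. -/
theorem homotopic_of_segment_subset {Z E : Type*} [TopologicalSpace Z] [NormedAddCommGroup E]
    [NormedSpace ℝ E] {M : Set E} (f g : C(Z, M))
    (h : ∀ z, segment ℝ (f z : E) (g z) ⊆ M) : f.Homotopic g := by
  have hmem : ∀ p : unitInterval × Z,
      AffineMap.lineMap (f p.2 : E) (g p.2 : E) (p.1 : ℝ) ∈ M := by
    rintro ⟨t, z⟩
    refine h z ?_
    rw [segment_eq_image_lineMap]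
    exact mem_image_of_mem _ t.2
  refine ⟨⟨⟨fun p => ⟨_, hmem p⟩, ?_⟩, ?_, ?_⟩⟩
  · refine Continuous.subtype_mk ?_ _
    simp only [AffineMap.lineMap_apply_module]
    fun_prop
  · intro z; simp
  · intro z; simp

theorem ContractibleIn.mono {X : Type*} [TopologicalSpace X] {A B M : Set X} (hAB : A ⊆ B)
    (h : ContractibleIn B M) : ContractibleIn A M := by
  obtain ⟨hB, hn⟩ := h
  exact ⟨hAB.trans hB, hn.comp_left ⟨inclusion hAB, continuous_inclusion hAB⟩⟩

theorem contractibleIn_of_segment_subset {E : Type*} [NormedAddCommGroup E] [NormedSpace ℝ E]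
    {A M : Set E} (m : M) (h : ∀ x ∈ A, segment ℝ x m ⊆ M) : ContractibleIn A M :=
  ⟨fun x hx => h x hx (left_mem_segment ℝ x m), m,
    homotopic_of_segment_subset _ _ fun z => h z z.2⟩

/-- A compact set that is contractible in an open subset of a normed space has a neighbourhood
with the same property. -/
theorem ContractibleIn.exists_cthickening {E : Type*} [NormedAddCommGroup E] [NormedSpace ℝ E]
    {A M : Set E} (hM : IsOpen M) (hA : IsCompact A) (h : ContractibleIn A M) :
    ∃ δ : ℝ, 0 < δ ∧ ContractibleIn (Metric.cthickening δ A) M := by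
  obtain ⟨hAM, m, ⟨H⟩⟩ := h
  have : CompactSpace A := isCompact_iff_compactSpace.1 hA
  -- `P` is the trace of the homotopy; inserting `m` puts it in `P` even when `A` is empty.
  set P : Set E := insert (m : E) (range fun p : unitInterval × A => (H p : E)) with hP
  have hHc : Continuous fun p : unitInterval × A => (H p : E) :=
    continuous_subtype_val.comp H.continuous
  have hPc : IsCompact P := (isCompact_range hHc).insert _
  have hPM : P ⊆ M := by
    rintro x (rfl | ⟨p, rfl⟩)
    · exact m.2
    · exact (H p).2
  obtain ⟨ρ, hρ, hρM⟩ := hPc.exists_thickening_subset_open hM hPM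
  -- Approximate extension of `H` to all of `E`: over `A` the values must lie in a ball around `H`,
  -- off the closed set `A` there is no constraint. The constraints are convex and locally met by
  -- constants, so a partition of unity solves them.
  obtain ⟨g, hg⟩ : ∃ g : C(unitInterval × E, E), ∀ p : unitInterval × E,
      g p ∈ {y : E | ∀ hx : p.2 ∈ A, dist y (H (p.1, ⟨p.2, hx⟩) : E) < ρ / 2} := by
    refine exists_continuous_forall_mem_convex_of_local_const ?_ ?_
    · rintro ⟨t, x⟩
      by_cases hx : x ∈ A
      · convert! convex_ball (H (t, ⟨x, hx⟩) : E) (ρ / 2)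
        ext y; simp [hx]
      · convert! convex_univ
        ext y; simp [hx]
    · rintro ⟨t, x⟩
      by_cases hx : x ∈ A
      · refine ⟨H (t, ⟨x, hx⟩), ?_⟩
        have h1 : ∀ᶠ q in 𝓝 (t, (⟨x, hx⟩ : A)),
            dist (H (t, ⟨x, hx⟩) : E) (H q : E) < ρ / 2 :=
          (continuous_const.dist hHc).continuousAt.eventually_lt continuousAt_const
            (by simpa using half_pos hρ)
        have hi : IsInducing (Prod.map id Subtype.val : unitInterval × A → unitInterval × E) :=
          IsInducing.id.prodMap IsInducing.subtypeVal
        rw [hi.nhds_eq_comap, eventually_comap] at h1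
        filter_upwards [h1] with q hq hx'
        exact hq (q.1, ⟨q.2, hx'⟩) rfl
      · refine ⟨0, ?_⟩
        have : ∀ᶠ q : unitInterval × E in 𝓝 (t, x), q.2 ∈ Aᶜ :=
          continuous_snd.continuousAt.eventually (hA.isClosed.isOpen_compl.mem_nhds hx)
        filter_upwards [this] with q hq hx'
        exact absurd hx' hq
  have hev : ∀ᶠ x in 𝓝ˢ A, (∀ t, g (t, x) ∈ Metric.thickening (ρ / 2) P) ∧
      x ∈ Metric.thickening (ρ / 2) P ∧ dist (g (0, x)) x < ρ / 2 ∧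
      dist (g (1, x)) m < ρ / 2 := by
    rw [eventually_nhdsSet_iff_forall]
    intro x hx
    have hgc := g.continuous
    refine Eventually.and ?_ (Eventually.and ?_ (Eventually.and ?_ ?_))
    · have := isCompact_univ (X := unitInterval).eventually_forall_of_forall_eventually (x₀ := x)
        (P := fun y t => g (t, y) ∈ Metric.thickening (ρ / 2) P) ?_
      · filter_upwards [this] with y hy t using hy t (mem_univ t)
      · intro t _
        have hc : Continuous fun z : E × unitInterval => g (z.2, z.1) := by fun_prop
        refine hc.continuousAt.eventually (Metric.isOpen_thickening.mem_nhds ?_)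
        exact Metric.mem_thickening_iff.2 ⟨_, Or.inr ⟨_, rfl⟩, hg (t, x) hx⟩
    · refine Metric.isOpen_thickening.mem_nhds (Metric.self_subset_thickening (half_pos hρ) P ?_)
      refine Or.inr ⟨(0, ⟨x, hx⟩), ?_⟩
      simp
    · refine ContinuousAt.eventually_lt (by fun_prop) continuousAt_const ?_
      simpa using hg (0, x) hx
    · refine ContinuousAt.eventually_lt (by fun_prop) continuousAt_const ?_
      simpa using hg (1, x) hx
  obtain ⟨δ, hδ, hδs⟩ := (Metric.hasBasis_nhdsSet_cthickening hA).mem_iff.1 hev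
  have hU : ∀ x ∈ Metric.cthickening δ A, _ := fun x hx => hδs hx
  have hball : ∀ p ∈ P, Metric.ball p ρ ⊆ M := fun p hp x hx =>
    hρM (Metric.mem_thickening_iff.2 ⟨p, hp, hx⟩)
  have hhalf : Metric.thickening (ρ / 2) P ⊆ M :=
    (Metric.thickening_mono (by linarith) P).trans hρM
  refine ⟨δ, hδ, fun x hx => hhalf (hU x hx).2.1, m, ?_⟩
  let G : C(unitInterval × Metric.cthickening δ A, M) :=
    ⟨fun p => ⟨g (p.1, p.2), hhalf ((hU _ p.2.2).1 p.1)⟩, by fun_prop⟩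
  let g₀ : C(Metric.cthickening δ A, M) := G.comp ⟨fun x => (0, x), by fun_prop⟩
  let g₁ : C(Metric.cthickening δ A, M) := G.comp ⟨fun x => (1, x), by fun_prop⟩
  have h01 : g₀.Homotopic g₁ := ⟨⟨G, fun _ => rfl, fun _ => rfl⟩⟩
  -- Three homotopies in succession: the segment from `x` to `g (0, x)`, then `g`, then the segment
  -- from `g (1, x)` to `m`.
  refine ContinuousMap.Homotopic.trans (homotopic_of_segment_subset _ g₀ fun x => ?_)
    (h01.trans (homotopic_of_segment_subset _ _ fun x => ?_))
  · obtain ⟨-, hx, hd, -⟩ := hU x x.2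
    obtain ⟨p, hp, hpx⟩ := Metric.mem_thickening_iff.1 hx
    refine ((convex_ball p ρ).segment_subset (Metric.mem_ball.2 ?_) (Metric.mem_ball.2 ?_)).trans
      (hball p hp)
    · exact hpx.trans (by linarith)
    · calc dist (g (0, x)) p ≤ dist (g (0, x)) x + dist (x : E) p := dist_triangle _ _ _
        _ < ρ := by linarith
  · obtain ⟨-, -, -, hd⟩ := hU x x.2
    refine ((convex_ball (m : E) ρ).segment_subset (Metric.mem_ball.2 ?_)
      (Metric.mem_ball_self hρ)).trans (hball m (Or.inl rfl))
    exact hd.trans (by linarith)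

/-! ### Lusternik–Schnirelmann category -/

section RelCat

variable {X : Type*} [TopologicalSpace X] {A B M : Set X}

theorem relCat_le_natCast_iff {n : ℕ} : relCat A M ≤ n ↔ ∃ k ≤ n, ∃ C : Fin k → Set X,
    (∀ i, IsClosed (C i) ∧ ContractibleIn (C i) M) ∧ A ⊆ ⋃ i, C i := by
  constructor
  · intro h
    have hne : {k : ℕ∞ | ∃ n : ℕ, k = n ∧ ∃ C : Fin n → Set X,
        (∀ i, IsClosed (C i) ∧ ContractibleIn (C i) M) ∧ A ⊆ ⋃ i, C i}.Nonempty := by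
      by_contra hne
      rw [not_nonempty_iff_eq_empty] at hne
      rw [relCat, hne, sInf_empty] at h
      exact absurd h (by simp)
    obtain ⟨k, hk, hC⟩ := csInf_mem hne
    refine ⟨k, ?_, hC⟩
    rw [relCat, hk] at h
    exact_mod_cast h
  · rintro ⟨k, hk, hC⟩
    calc relCat A M ≤ k := sInf_le ⟨k, rfl, hC⟩
      _ ≤ n := by exact_mod_cast hk

theorem relCat_le_of_cover {n : ℕ} (C : Fin n → Set X)
    (hC : ∀ i, IsClosed (C i) ∧ ContractibleIn (C i) M) (hA : A ⊆ ⋃ i, C i) : relCat A M ≤ n :=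
  relCat_le_natCast_iff.2 ⟨n, le_rfl, C, hC, hA⟩

theorem exists_cover_of_relCat_ne_top (h : relCat A M ≠ ⊤) : ∃ (n : ℕ) (C : Fin n → Set X),
    relCat A M = n ∧ (∀ i, IsClosed (C i) ∧ ContractibleIn (C i) M) ∧ A ⊆ ⋃ i, C i := by
  obtain ⟨n, hn⟩ := ENat.ne_top_iff_exists.1 h
  obtain ⟨k, hk, C, hC, hA⟩ := relCat_le_natCast_iff.1 hn.ge
  have : relCat A M ≤ k := relCat_le_of_cover C hC hA
  refine ⟨k, C, le_antisymm this ?_, hC, hA⟩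
  rw [← hn]
  exact_mod_cast hk

theorem relCat_mono (h : A ⊆ B) : relCat A M ≤ relCat B M := by
  by_cases hB : relCat B M = ⊤
  · simp [hB]
  obtain ⟨n, C, hn, hC, hc⟩ := exists_cover_of_relCat_ne_top hB
  exact hn ▸ relCat_le_of_cover C hC (h.trans hc)

theorem relCat_empty : relCat (∅ : Set X) M = 0 :=
  le_antisymm (relCat_le_of_cover (n := 0) Fin.elim0 (fun i => i.elim0) (empty_subset _))
    zero_le

theorem relCat_union_le : relCat (A ∪ B) M ≤ relCat A M + relCat B M := by
  by_cases hA : relCat A M = ⊤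
  · simp [hA]
  by_cases hB : relCat B M = ⊤
  · simp [hB]
  obtain ⟨n, C, hn, hC, hc⟩ := exists_cover_of_relCat_ne_top hA
  obtain ⟨k, C', hk, hC', hc'⟩ := exists_cover_of_relCat_ne_top hB
  rw [hn, hk, ← Nat.cast_add]
  refine relCat_le_of_cover (Fin.append C C') (fun i => ?_) ?_
  · refine Fin.addCases (fun i => ?_) (fun i => ?_) i
    · simpa using hC i
    · simpa using hC' i
  · refine union_subset (hc.trans (iUnion_subset fun i => ?_))
      (hc'.trans (iUnion_subset fun i => ?_))
    · exact subset_iUnion_of_subset (Fin.castAdd k i) (by simp)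
    · exact subset_iUnion_of_subset (Fin.natAdd n i) (by simp)

/-- The category does not decrease under a deformation in `M`. -/
theorem relCat_le_of_homotopic (hA : IsClosed A) (hAM : A ⊆ M)
    (f : C(A, M)) (hf : ContinuousMap.Homotopic ⟨inclusion hAM, continuous_inclusion hAM⟩ f)
    (hB : ∀ x, (f x : X) ∈ B) : relCat A M ≤ relCat B M := by
  by_cases hBt : relCat B M = ⊤
  · simp [hBt]
  obtain ⟨n, C, hn, hC, hc⟩ := exists_cover_of_relCat_ne_top hBt
  rw [hn]
  -- Pull the cover of `B` back along `f`: each piece is deformed by `hf` into `C i` and contracted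
  -- there.
  refine relCat_le_of_cover (fun i => Subtype.val '' {x : A | (f x : X) ∈ C i}) (fun i => ?_) ?_
  · have hsub : Subtype.val '' {x : A | (f x : X) ∈ C i} ⊆ A := by rintro _ ⟨x, -, rfl⟩; exact x.2
    refine ⟨hA.isClosedEmbedding_subtypeVal.isClosedMap _
      ((hC i).1.preimage (by fun_prop)), hsub.trans hAM, ?_⟩
    obtain ⟨hCM, m, hm⟩ := (hC i).2
    refine ⟨m, ?_⟩
    let j : C(Subtype.val '' {x : A | (f x : X) ∈ C i}, A) :=
      ⟨inclusion hsub, continuous_inclusion hsub⟩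
    have hj : ∀ x, (f (j x) : X) ∈ C i := by
      rintro ⟨_, x, hx, rfl⟩
      exact hx
    let q : C(Subtype.val '' {x : A | (f x : X) ∈ C i}, C i) :=
      ⟨fun x => ⟨f (j x), hj x⟩, by fun_prop⟩
    exact (hf.comp (.refl j)).trans (hm.comp (.refl q))
  · intro x hx
    obtain ⟨i, hi⟩ := mem_iUnion.1 (hc (hB ⟨x, hx⟩))
    exact mem_iUnion.2 ⟨i, ⟨x, hx⟩, hi, rfl⟩

end RelCat

/-- Continuity of the category: a compact subset of an open set has a neighbourhood of no larger
category. -/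
theorem exists_relCat_thickening_le {E : Type*} [NormedAddCommGroup E] [NormedSpace ℝ E]
    {A M : Set E} (hM : IsOpen M) (hA : IsCompact A) :
    ∃ δ : ℝ, 0 < δ ∧ relCat (Metric.thickening δ A) M ≤ relCat A M := by
  by_cases hAt : relCat A M = ⊤
  · exact ⟨1, one_pos, by simp [hAt]⟩
  obtain ⟨n, C, hn, hC, hc⟩ := exists_cover_of_relCat_ne_top hAt
  -- The sets `C i` need not be compact, so only their traces on `A` are thickened.
  have : ∀ i, ∃ δ : ℝ, 0 < δ ∧ ContractibleIn (Metric.cthickening δ (A ∩ C i)) M := fun i =>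
    ContractibleIn.exists_cthickening hM (hA.inter_right (hC i).1)
      ((hC i).2.mono inter_subset_right)
  choose δ hδ hδC using this
  obtain ⟨ε, hε, hεδ⟩ : ∃ ε : ℝ, 0 < ε ∧ ∀ i, ε ≤ δ i := by
    have : ∀ᶠ ε in 𝓝[>] (0 : ℝ), 0 < ε ∧ ∀ i, ε ≤ δ i := by
      refine eventually_mem_nhdsWithin.and (eventually_all.2 fun i => ?_)
      exact mem_nhdsWithin_of_mem_nhds (Iic_mem_nhds (hδ i))
    exact this.exists
  refine ⟨ε, hε, hn ▸ relCat_le_of_cover (fun i => Metric.cthickening (δ i) (A ∩ C i))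
    (fun i => ⟨Metric.isClosed_cthickening, hδC i⟩) fun x hx => ?_⟩
  obtain ⟨a, ha, hxa⟩ := Metric.mem_thickening_iff.1 hx
  obtain ⟨i, hi⟩ := mem_iUnion.1 (hc ha)
  exact mem_iUnion.2 ⟨i, Metric.thickening_subset_cthickening_of_le (hεδ i) _
    (Metric.mem_thickening_iff.2 ⟨a, ⟨ha, hi⟩, hxa⟩)⟩

/-! ### Ekeland's variational principle -/

/-- Ekeland's variational principle, for a function on a subset of a complete metric space whose
sublevel sets are closed. -/
theorem exists_ekeland_point {α : Type*} [MetricSpace α] [CompleteSpace α] {S : Set α} {f : α → ℝ}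
    {c κ : ℝ} (hbdd : ∀ x ∈ S, c ≤ f x) (hcl : ∀ q : ℝ, IsClosed {x | x ∈ S ∧ f x ≤ q})
    (hκ : 0 < κ) {x₀ : α} (h₀ : x₀ ∈ S) :
    ∃ x ∈ S, f x + κ * dist x x₀ ≤ f x₀ ∧ ∀ y ∈ S, y ≠ x → f x < f y + κ * dist y x := by
  let M : α → Set α := fun x => {y | y ∈ S ∧ f y + κ * dist y x ≤ f x}
  have hself : ∀ x ∈ S, x ∈ M x := fun x hx => ⟨hx, by simp⟩
  have htrans : ∀ {x y z}, y ∈ M x → z ∈ M y → z ∈ M x := by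
    rintro x y z ⟨hy, hxy⟩ ⟨hz, hyz⟩
    refine ⟨hz, ?_⟩
    have := mul_le_mul_of_nonneg_left (dist_triangle z y x) hκ.le
    linarith
  have hnext : ∀ (n : ℕ) (x : S), ∃ y : S, (y : α) ∈ M x ∧
      ∀ z ∈ M x, f y ≤ f z + (1 / 2) ^ n := by
    rintro n ⟨x, hx⟩
    have hb : BddBelow (f '' M x) := ⟨c, by rintro _ ⟨y, hy, rfl⟩; exact hbdd y hy.1⟩
    obtain ⟨_, ⟨y, hy, rfl⟩, hlt⟩ := exists_lt_of_csInf_lt ⟨_, mem_image_of_mem f (hself x hx)⟩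
      (lt_add_of_pos_right (sInf (f '' M x)) (pow_pos (one_half_pos (α := ℝ)) n))
    exact ⟨⟨y, hy.1⟩, hy, fun z hz => hlt.le.trans
      (add_le_add_left (csInf_le hb (mem_image_of_mem f hz)) _)⟩
  choose next hnM hnf using hnext
  let u : ℕ → S := fun n => Nat.rec ⟨x₀, h₀⟩ (fun n x => next n x) n
  have hu : ∀ n, u (n + 1) = next n (u n) := fun n => rfl
  have hmem : ∀ n m : ℕ, n ≤ m → (u m).1 ∈ M (u n).1 := by
    intro n m hnm
    induction m, hnm using Nat.le_induction with
    | base => exact hself _ (u n).2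
    | succ m _ ih => exact htrans ih (hnM m (u m))
  -- Since `u (n + 1)` nearly minimises `f` on `M (u n)`, which contains `M (u (n + 1))`, the latter
  -- sets shrink to a point.
  have hsmall : ∀ n, ∀ z ∈ M (u (n + 1)).1, dist z (u (n + 1)).1 ≤ (1 / 2) ^ n / κ := by
    intro n z hz
    have h1 := hnf n (u n) z (htrans (hmem n (n + 1) n.le_succ) hz)
    rw [← hu] at h1
    rw [le_div_iff₀ hκ]
    have := hz.2
    nlinarith
  have hlim : Tendsto (fun n : ℕ => (1 / 2 : ℝ) ^ n / κ) atTop (𝓝 0) := by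
    simpa using (tendsto_pow_atTop_nhds_zero_of_lt_one (r := (1 / 2 : ℝ))
      (by norm_num) (by norm_num)).div_const κ
  have hcau : CauchySeq fun n => (u (n + 1)).1 := by
    refine cauchySeq_of_le_tendsto_0' (fun n => (1 / 2 : ℝ) ^ n / κ) (fun n m hnm => ?_) hlim
    rw [dist_comm]
    exact hsmall n _ (hmem (n + 1) (m + 1) (by omega))
  obtain ⟨x, hx⟩ := cauchySeq_tendsto_of_complete hcau
  have hxM : ∀ n, x ∈ M (u n).1 := by
    intro n
    -- Closedness is available only for a fixed level; the slack `δ` absorbs the variation of the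
    -- distance along the sequence.
    have key : ∀ δ > 0, x ∈ S ∧ f x ≤ f (u n).1 - κ * (dist x (u n).1 - δ) := by
      intro δ hδ
      refine (hcl _).mem_of_tendsto hx ?_
      have h1 : ∀ᶠ m in atTop, dist x (u n).1 - δ < dist (u (m + 1)).1 (u n).1 :=
        (hx.dist tendsto_const_nhds).eventually (lt_mem_nhds (by linarith))
      filter_upwards [h1, eventually_ge_atTop n] with m hm hnm
      have h2 := hmem n (m + 1) (by omega)
      refine ⟨h2.1, ?_⟩
      have := mul_le_mul_of_nonneg_left hm.le hκ.le
      linarith [h2.2]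
    refine ⟨(key 1 one_pos).1, ?_⟩
    refine le_of_forall_pos_le_add fun ε hε => ?_
    have := (key (ε / κ) (by positivity)).2
    rw [mul_sub, mul_div_cancel₀ _ hκ.ne'] at this
    linarith
  refine ⟨x, (hxM 0).1, (hxM 0).2, fun y hy hyx => ?_⟩
  by_contra hcon
  have hyM : y ∈ M x := ⟨hy, not_lt.1 hcon⟩
  have hy' : Tendsto (fun n => (u (n + 1)).1) atTop (𝓝 y) := by
    rw [tendsto_iff_dist_tendsto_zero]
    refine squeeze_zero (fun _ => dist_nonneg) (fun n => ?_) hlim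
    rw [dist_comm]
    exact hsmall n y (htrans (hxM (n + 1)) hyM)
  exact hyx (tendsto_nhds_unique hy' hx)

/-! ### Uniform bounds on difference quotients -/

section DescentBound

variable {X : Type*} [NormedAddCommGroup X] [NormedSpace ℝ X]

/-- `a` bounds the difference quotients of `φ` at all points near `u`, for small positive steps, in
all directions near `v`. -/
def DescentBound (φ : X → ℝ) (u v : X) (a : ℝ) : Prop :=
  ∀ᶠ p : X × ℝ × X in 𝓝 u ×ˢ 𝓝[>] (0 : ℝ) ×ˢ 𝓝 v,
    φ (p.1 + p.2.1 • p.2.2) - φ p.1 ≤ p.2.1 * a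

variable {φ : X → ℝ} {u v v' : X} {a a' : ℝ}

theorem DescentBound.smul (h : DescentBound φ u v a) {r : ℝ} (hr : 0 < r) :
    DescentBound φ u (r • v) (r * a) := by
  have ht : Tendsto (fun p : X × ℝ × X => (p.1, p.2.1 * r, r⁻¹ • p.2.2))
      (𝓝 u ×ˢ 𝓝[>] (0 : ℝ) ×ˢ 𝓝 (r • v)) (𝓝 u ×ˢ 𝓝[>] (0 : ℝ) ×ˢ 𝓝 v) := by
    refine tendsto_fst.prodMk (Tendsto.prodMk ?_ ?_)
    · refine tendsto_nhdsWithin_iff.2 ⟨?_, ?_⟩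
      · have h1 : Tendsto (fun t : ℝ => t * r) (𝓝[>] 0) (𝓝 0) := by
          have : Tendsto (fun t : ℝ => t * r) (𝓝 0) (𝓝 (0 * r)) :=
            (continuous_id.mul continuous_const).continuousAt
          rw [zero_mul] at this
          exact this.mono_left nhdsWithin_le_nhds
        exact h1.comp (tendsto_fst.comp tendsto_snd)
      · filter_upwards [(tendsto_fst.comp tendsto_snd).eventually
          (self_mem_nhdsWithin (a := (0 : ℝ)) (s := Ioi 0))] with p hp
        exact mul_pos hp hr
    · have h1 : Tendsto (fun q : X => r⁻¹ • q) (𝓝 (r • v)) (𝓝 v) := by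
        have : Tendsto (fun q : X => r⁻¹ • q) (𝓝 (r • v)) (𝓝 (r⁻¹ • r • v)) :=
          (continuous_const_smul _).continuousAt
        rwa [inv_smul_smul₀ hr.ne'] at this
      exact h1.comp (tendsto_snd.comp tendsto_snd)
  filter_upwards [ht.eventually h] with p hp
  rw [mul_smul, smul_inv_smul₀ hr.ne', mul_assoc] at hp
  exact hp

/-- The step `t • q` is `t • (q - v')` followed by `t • v'`. The intermediate point still tends to
`u`, which is why the bound is required at all base points near `u`. -/
theorem DescentBound.add (h : DescentBound φ u v a) (h' : DescentBound φ u v' a') :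
    DescentBound φ u (v + v') (a + a') := by
  have hw : Tendsto (fun p : X × ℝ × X => p.1) (𝓝 u ×ˢ 𝓝[>] (0 : ℝ) ×ˢ 𝓝 (v + v')) (𝓝 u) :=
    tendsto_fst
  have hr : Tendsto (fun p : X × ℝ × X => p.2.1) (𝓝 u ×ˢ 𝓝[>] (0 : ℝ) ×ˢ 𝓝 (v + v'))
      (𝓝[>] 0) := tendsto_fst.comp tendsto_snd
  have hq : Tendsto (fun p : X × ℝ × X => p.2.2 - v') (𝓝 u ×ˢ 𝓝[>] (0 : ℝ) ×ˢ 𝓝 (v + v'))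
      (𝓝 v) := by
    simpa using (tendsto_snd.comp tendsto_snd :
      Tendsto (fun p : X × ℝ × X => p.2.2) (𝓝 u ×ˢ 𝓝[>] (0 : ℝ) ×ˢ 𝓝 (v + v')) _).sub_const v'
  have hw' : Tendsto (fun p : X × ℝ × X => p.1 + p.2.1 • (p.2.2 - v'))
      (𝓝 u ×ˢ 𝓝[>] (0 : ℝ) ×ˢ 𝓝 (v + v')) (𝓝 u) := by
    simpa using hw.add ((hr.mono_right nhdsWithin_le_nhds).smul hq)
  filter_upwards [(hw.prodMk (hr.prodMk hq)).eventually h,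
    (hw'.prodMk (hr.prodMk tendsto_const_nhds)).eventually h'] with p h1 h2
  have e : p.1 + p.2.1 • (p.2.2 - v') + p.2.1 • v' = p.1 + p.2.1 • p.2.2 := by
    rw [smul_sub]; abel
  simp only [e] at h1 h2
  linarith

/-- This lets a direction found at one point serve, with the same `a`, at all nearby points. -/
theorem DescentBound.eventually (h : DescentBound φ u v a) :
    ∀ᶠ p : X × X in 𝓝 (u, v), DescentBound φ p.1 p.2 a := by
  obtain ⟨P, hP, Q, hQ, hPQ⟩ := eventually_prod_iff.1 h
  obtain ⟨R, hR, V, hV, hRV⟩ := eventually_prod_iff.1 hQ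
  rw [nhds_prod_eq]
  filter_upwards [prod_mem_prod hP.eventually_nhds hV.eventually_nhds] with p hp
  exact eventually_prod_iff.2 ⟨P, hp.1, _, hR.prod_mk hp.2, fun hx y hy => hPQ hx (hRV hy.1 hy.2)⟩

/-- `genDeriv` sees only the direction `v`; replacing it by a nearby `q` costs at most `K * ‖q - v‖`
per unit step, which the strict gap absorbs. -/
theorem descentBound_of_genDeriv_lt {Φ : X → EReal} {K : NNReal} {s : Set X} (hs : s ∈ 𝓝 u)
    (hL : LipschitzOnWith K (fun x => (Φ x).toReal) s) (h : genDeriv Φ u v < (a : EReal)) :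
    DescentBound (fun x => (Φ x).toReal) u v a := by
  obtain ⟨a', h1, h2⟩ := EReal.lt_iff_exists_real_btwn.1 h
  have h2 : a' < a := by exact_mod_cast h2
  have hev := eventually_lt_of_limsup_lt h1
  have hw : Tendsto (fun p : X × ℝ × X => p.1) (𝓝 u ×ˢ 𝓝[>] (0 : ℝ) ×ˢ 𝓝 v) (𝓝 u) := tendsto_fst
  have hr : Tendsto (fun p : X × ℝ × X => p.2.1) (𝓝 u ×ˢ 𝓝[>] (0 : ℝ) ×ˢ 𝓝 v)
      (𝓝[>] 0) := tendsto_fst.comp tendsto_snd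
  have hq : Tendsto (fun p : X × ℝ × X => p.2.2) (𝓝 u ×ˢ 𝓝[>] (0 : ℝ) ×ˢ 𝓝 v)
      (𝓝 v) := tendsto_snd.comp tendsto_snd
  have hr0 := hr.mono_right nhdsWithin_le_nhds
  have hm1 : Tendsto (fun p : X × ℝ × X => p.1 + p.2.1 • p.2.2)
      (𝓝 u ×ˢ 𝓝[>] (0 : ℝ) ×ˢ 𝓝 v) (𝓝 u) := by
    simpa using hw.add (hr0.smul hq)
  have hm2 : Tendsto (fun p : X × ℝ × X => p.1 + p.2.1 • v)
      (𝓝 u ×ˢ 𝓝[>] (0 : ℝ) ×ˢ 𝓝 v) (𝓝 u) := by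
    simpa using hw.add (hr0.smul (tendsto_const_nhds (x := v)))
  have hd : Tendsto (fun p : X × ℝ × X => a' + K * ‖p.2.2 - v‖)
      (𝓝 u ×ˢ 𝓝[>] (0 : ℝ) ×ˢ 𝓝 v) (𝓝 a') := by
    simpa using ((hq.sub_const v).norm.const_mul (K : ℝ)).const_add a'
  filter_upwards [(hw.prodMk hr).eventually hev, hm1.eventually hs, hm2.eventually hs,
    hr.eventually self_mem_nhdsWithin, hd.eventually (gt_mem_nhds h2)] with p e1 e2 e3 e4 e5
  have e4 : 0 < p.2.1 := e4
  have e1' := EReal.coe_lt_coe_iff.1 e1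
  rw [div_lt_iff₀ e4] at e1'
  have e6 := (le_abs_self _).trans (hL.dist_le_mul _ e2 _ e3)
  rw [dist_eq_norm, add_sub_add_left_eq_sub, ← smul_sub, norm_smul, Real.norm_of_nonneg e4.le] at e6
  have e7 := mul_lt_mul_of_pos_left e5 e4
  nlinarith

theorem genDeriv_ne_bot {Φ : X → EReal} {K : NNReal} {s : Set X} (hs : s ∈ 𝓝 u)
    (hL : LipschitzOnWith K (fun x => (Φ x).toReal) s) : genDeriv Φ u v ≠ ⊥ := by
  have hw : Tendsto (fun p : X × ℝ => p.1) (𝓝 u ×ˢ 𝓝[>] (0 : ℝ)) (𝓝 u) := tendsto_fst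
  have hr : Tendsto (fun p : X × ℝ => p.2) (𝓝 u ×ˢ 𝓝[>] (0 : ℝ)) (𝓝[>] 0) := tendsto_snd
  have hm : Tendsto (fun p : X × ℝ => p.1 + p.2 • v) (𝓝 u ×ˢ 𝓝[>] (0 : ℝ)) (𝓝 u) := by
    simpa using hw.add ((hr.mono_right nhdsWithin_le_nhds).smul (tendsto_const_nhds (x := v)))
  have hev : ∀ᶠ p : X × ℝ in 𝓝 u ×ˢ 𝓝[>] (0 : ℝ), ((-(K * ‖v‖) : ℝ) : EReal) ≤
      ((((Φ (p.1 + p.2 • v)).toReal - (Φ p.1).toReal) / p.2 : ℝ) : EReal) := by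
    filter_upwards [hw.eventually hs, hm.eventually hs, hr.eventually self_mem_nhdsWithin]
      with p e1 e2 e3
    have e3 : 0 < p.2 := e3
    rw [EReal.coe_le_coe_iff, le_div_iff₀ e3]
    have e4 := (neg_abs_le _).trans' (neg_le_neg (hL.dist_le_mul _ e2 _ e1))
    rw [dist_eq_norm, add_sub_cancel_left, norm_smul, Real.norm_of_nonneg e3.le] at e4
    nlinarith
  have := le_limsup_of_frequently_le hev.frequently
  intro h0
  rw [genDeriv] at h0
  rw [h0, le_bot_iff] at this
  exact EReal.coe_ne_bot _ this

theorem genDeriv_zero (Φ : X → EReal) : genDeriv Φ u 0 = 0 := by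
  simp [genDeriv]

end DescentBound

/-! ### The energy and the rescaled descent inequality -/

section Energy

variable {X : Type*} [NormedAddCommGroup X] [NormedSpace ℝ X] {ψ Φ : X → EReal} {x : X}

theorem StructuralAssumption.mem_domain_of_energy_lt_top (hI : StructuralAssumption ψ Φ)
    (h : energy ψ Φ x < ⊤) : x ∈ effDomain ψ ∩ effDomain Φ := by
  have := (EReal.add_ne_top_iff_ne_top₂ (hI.psi_ne_bot x) (hI.phi_ne_bot x)).1 h.ne
  exact ⟨lt_top_iff_ne_top.2 this.1, lt_top_iff_ne_top.2 this.2⟩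

theorem StructuralAssumption.coe_psi (hI : StructuralAssumption ψ Φ) (h : x ∈ effDomain ψ) :
    (((ψ x).toReal : ℝ) : EReal) = ψ x :=
  EReal.coe_toReal (ne_of_lt h) (hI.psi_ne_bot x)

theorem StructuralAssumption.coe_phi (hI : StructuralAssumption ψ Φ) (h : x ∈ effDomain Φ) :
    (((Φ x).toReal : ℝ) : EReal) = Φ x :=
  EReal.coe_toReal (ne_of_lt h) (hI.phi_ne_bot x)

theorem StructuralAssumption.energy_eq_coe (hI : StructuralAssumption ψ Φ)
    (h : x ∈ effDomain ψ ∩ effDomain Φ) :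
    energy ψ Φ x = (((ψ x).toReal + (Φ x).toReal : ℝ) : EReal) := by
  rw [EReal.coe_add, hI.coe_psi h.1, hI.coe_phi h.2, energy]

theorem StructuralAssumption.exists_lipschitzOnWith (hI : StructuralAssumption ψ Φ)
    (h : x ∈ effDomain Φ) :
    ∃ K : NNReal, ∃ s ∈ 𝓝 x, LipschitzOnWith K (fun x => (Φ x).toReal) s := by
  obtain ⟨K, s, hs, hL⟩ := hI.phi_locallyLipschitz h
  exact ⟨K, s, hI.isOpen_domain.nhdsWithin_eq h ▸ hs, hL⟩

theorem StructuralAssumption.continuousOn_phi (hI : StructuralAssumption ψ Φ) :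
    ContinuousOn (fun x => (Φ x).toReal) (effDomain Φ) :=
  hI.phi_locallyLipschitz.continuousOn

/-- On a compact subset of D_Φ, Φ is bounded below, so a bound on I bounds ψ and the continuity
assumption on ψ applies. -/
theorem StructuralAssumption.continuousOn_psi (hI : StructuralAssumption ψ Φ) {A : Set X}
    (hA : IsCompact A) (hne : A.Nonempty) {s : ℝ} (hs : ∀ u ∈ A, energy ψ Φ u ≤ s) :
    ContinuousOn (fun x => (ψ x).toReal) A := by
  have hdom : ∀ u ∈ A, u ∈ effDomain ψ ∩ effDomain Φ := fun u hu =>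
    hI.mem_domain_of_energy_lt_top ((hs u hu).trans_lt (EReal.coe_lt_top s))
  obtain ⟨m, hm⟩ := hA.bddBelow_image (hI.continuousOn_phi.mono fun u hu => (hdom u hu).2)
  have hle : ∀ u ∈ A, ψ u ≤ ((s - m : ℝ) : EReal) := fun u hu => by
    have h1 := hs u hu
    rw [hI.energy_eq_coe (hdom u hu), EReal.coe_le_coe_iff] at h1
    rw [← hI.coe_psi (hdom u hu).1, EReal.coe_le_coe_iff]
    have h2 : m ≤ (Φ u).toReal := hm (mem_image_of_mem _ hu)
    linarith
  have hc := hI.psi_continuousOn A hne hA ((iSup₂_le hle).trans_lt (EReal.coe_lt_top _))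
  intro u hu
  exact (EReal.tendsto_toReal (hdom u hu).1.ne (hI.psi_ne_bot u)).comp (hc u hu)

/-- This is the cone over the epigraph of ψ: `(l, y, b)` encodes the target `z = l⁻¹ • y` with `l *
ψ z ≤ b`. In these coordinates `y - l • u` is linear in the data, so directions normalised by
different factors can be averaged. -/
theorem StructuralAssumption.convex_perspective (hI : StructuralAssumption ψ Φ) :
    Convex ℝ {p : ℝ × X × ℝ | 0 < p.1 ∧ ψ (p.1⁻¹ • p.2.1) ≤ ((p.1⁻¹ * p.2.2 : ℝ) : EReal)} := by
  rw [convex_iff_forall_pos]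
  rintro ⟨l₁, y₁, b₁⟩ ⟨hl₁, h₁⟩ ⟨l₂, y₂, b₂⟩ ⟨hl₂, h₂⟩ α β hα hβ -
  simp only at hl₁ h₁ hl₂ h₂
  have hl : 0 < α * l₁ + β * l₂ := by positivity
  refine ⟨hl, ?_⟩
  simp only [Prod.smul_mk, Prod.mk_add_mk, smul_eq_mul]
  set l := α * l₁ + β * l₂
  have e : l⁻¹ • (α • y₁ + β • y₂) =
      (l⁻¹ * (α * l₁)) • (l₁⁻¹ • y₁) + (l⁻¹ * (β * l₂)) • (l₂⁻¹ • y₂) := by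
    simp only [smul_smul, smul_add]
    congr 2 <;> field_simp
  rw [e]
  refine (hI.psi_convex _ _ _ _ (by positivity) (by positivity) ?_).trans ?_
  · rw [← mul_add]; exact inv_mul_cancel₀ hl.ne'
  · refine (add_le_add (mul_le_mul_of_nonneg_left h₁ ?_) (mul_le_mul_of_nonneg_left h₂ ?_)).trans ?_
    · exact_mod_cast (by positivity : 0 ≤ l⁻¹ * (α * l₁))
    · exact_mod_cast (by positivity : 0 ≤ l⁻¹ * (β * l₂))
    · norm_cast
      refine le_of_eq ?_
      field_simp

/-- Rescaled form of a failure of the critical point inequality. -/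
theorem StructuralAssumption.exists_descent (hI : StructuralAssumption ψ Φ) {u z : X} {ε : ℝ}
    (hu : u ∈ effDomain ψ ∩ effDomain Φ)
    (hz : genDeriv Φ u (z - u) + ψ z - ψ u < ((-(ε * ‖z - u‖) : ℝ) : EReal)) :
    ∃ (l : ℝ) (y : X) (b a : ℝ), 0 < l ∧ ψ (l⁻¹ • y) ≤ ((l⁻¹ * b : ℝ) : EReal) ∧
      ‖y - l • u‖ < 2 ∧ DescentBound (fun x => (Φ x).toReal) u (y - l • u) a ∧
      a + b - l * (ψ u).toReal < -ε := by
  obtain ⟨K, s, hs, hL⟩ := hI.exists_lipschitzOnWith hu.2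
  have hgb : genDeriv Φ u (z - u) ≠ ⊥ := genDeriv_ne_bot hs hL
  rw [← hI.coe_psi hu.1, EReal.sub_lt_iff (Or.inl (EReal.coe_ne_bot _))
    (Or.inl (EReal.coe_ne_top _)), ← EReal.coe_add] at hz
  have hnt := (EReal.add_ne_top_iff_ne_top₂ hgb (hI.psi_ne_bot z)).1 (hz.trans (EReal.coe_lt_top _)).ne
  have hzd : z ∈ effDomain ψ := lt_top_iff_ne_top.2 hnt.2
  set g := (genDeriv Φ u (z - u)).toReal with hgdef
  have hg : genDeriv Φ u (z - u) = (g : EReal) := (EReal.coe_toReal hnt.1 hgb).symm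
  rw [hg, ← hI.coe_psi hzd, ← EReal.coe_add, EReal.coe_lt_coe_iff] at hz
  have hzu : z ≠ u := by
    rintro rfl
    rw [sub_self, genDeriv_zero, EReal.toReal_zero] at hgdef
    rw [sub_self, norm_zero, hgdef] at hz
    linarith
  have hd : 0 < ‖z - u‖ := norm_pos_iff.2 (sub_ne_zero.2 hzu)
  set d := ‖z - u‖ with hdd
  obtain ⟨a, ha1, ha2⟩ := exists_between (show g < -(ε * d) + (ψ u).toReal - (ψ z).toReal by linarith)
  have hD : DescentBound (fun x => (Φ x).toReal) u (z - u) a :=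
    descentBound_of_genDeriv_lt hs hL (hg ▸ EReal.coe_lt_coe_iff.2 ha1)
  -- Dividing by `d` makes the direction a unit vector; the bound 2 leaves room for `u` to vary.
  refine ⟨d⁻¹, d⁻¹ • z, d⁻¹ * (ψ z).toReal, d⁻¹ * a, inv_pos.2 hd, ?_, ?_, ?_, ?_⟩
  · rw [smul_smul, inv_inv, ← mul_assoc, mul_inv_cancel₀ hd.ne', one_smul, one_mul, hI.coe_psi hzd]
  · rw [← smul_sub, norm_smul, norm_inv, ← hdd, norm_norm, inv_mul_cancel₀ hd.ne']
    norm_num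
  · rw [← smul_sub]
    exact hD.smul (inv_pos.2 hd)
  · have h1 : d⁻¹ * (a + (ψ z).toReal - (ψ u).toReal) < d⁻¹ * (-(ε * d)) :=
      mul_lt_mul_of_pos_left (by linarith) (inv_pos.2 hd)
    have h2 : d⁻¹ * (-(ε * d)) = -ε := by field_simp
    rw [h2] at h1
    linarith

end Energy

/-! ### Deformation of compact sets -/

section Deformation

variable {X : Type*} [NormedAddCommGroup X] [NormedSpace ℝ X] {ψ Φ : X → EReal}

/-- Continuous choice of descent directions on a compact set, for the points at the top level. -/
theorem StructuralAssumption.exists_continuous_descent (hI : StructuralAssumption ψ Φ) {A : Set X}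
    (hA : IsCompact A) (hne : A.Nonempty) {s ε : ℝ} (hs : ∀ u ∈ A, energy ψ Φ u ≤ s)
    (hslope : ∀ u ∈ A, energy ψ Φ u = s →
      ∃ z, genDeriv Φ u (z - u) + ψ z - ψ u < ((-(ε * ‖z - u‖) : ℝ) : EReal)) :
    ∃ g : C(A, ℝ × X × ℝ), ∀ u : A, 0 < (g u).1 ∧
      ψ ((g u).1⁻¹ • (g u).2.1) ≤ (((g u).1⁻¹ * (g u).2.2 : ℝ) : EReal) ∧
      ‖(g u).2.1 - (g u).1 • (u : X)‖ < 2 ∧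
      ((ψ u).toReal + (Φ u).toReal = s → ∃ a,
        DescentBound (fun x => (Φ x).toReal) u ((g u).2.1 - (g u).1 • (u : X)) a ∧
        a + (g u).2.2 - (g u).1 * (ψ u).toReal < -ε) := by
  have hdom : ∀ u ∈ A, u ∈ effDomain ψ ∩ effDomain Φ := fun u hu =>
    hI.mem_domain_of_energy_lt_top ((hs u hu).trans_lt (EReal.coe_lt_top s))
  have hψ := continuousOn_iff_continuous_domRestrict.1 (hI.continuousOn_psi hA hne hs)
  have hΦ := continuousOn_iff_continuous_domRestrict.1
    (hI.continuousOn_phi.mono fun u hu => (hdom u hu).2)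
  refine exists_continuous_forall_mem_convex_of_local_const (t := fun u : A =>
    {p : ℝ × X × ℝ | 0 < p.1 ∧ ψ (p.1⁻¹ • p.2.1) ≤ ((p.1⁻¹ * p.2.2 : ℝ) : EReal) ∧
      ‖p.2.1 - p.1 • (u : X)‖ < 2 ∧
      ((ψ u).toReal + (Φ u).toReal = s → ∃ a,
        DescentBound (fun x => (Φ x).toReal) u (p.2.1 - p.1 • (u : X)) a ∧
        a + p.2.2 - p.1 * (ψ u).toReal < -ε)}) ?_ ?_
  · intro u
    rw [convex_iff_forall_pos]
    rintro ⟨l₁, y₁, b₁⟩ ⟨hl₁, h₁, n₁, d₁⟩ ⟨l₂, y₂, b₂⟩ ⟨hl₂, h₂, n₂, d₂⟩ α β hα hβ hαβ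
    have hper := convex_iff_forall_pos.1 hI.convex_perspective (x := (l₁, y₁, b₁)) ⟨hl₁, h₁⟩
      (y := (l₂, y₂, b₂)) ⟨hl₂, h₂⟩ hα hβ hαβ
    have e : (α • y₁ + β • y₂) - (α * l₁ + β * l₂) • (u : X) =
        α • (y₁ - l₁ • (u : X)) + β • (y₂ - l₂ • (u : X)) := by module
    refine ⟨hper.1, hper.2, ?_, fun hu => ?_⟩
    · simp only [Prod.smul_mk, Prod.mk_add_mk, smul_eq_mul]
      rw [e]
      have h1 : y₁ - l₁ • (u : X) ∈ Metric.ball (0 : X) 2 := by simpa using n₁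
      have h2 : y₂ - l₂ • (u : X) ∈ Metric.ball (0 : X) 2 := by simpa using n₂
      simpa using (convex_ball (0 : X) 2) h1 h2 hα.le hβ.le hαβ
    · obtain ⟨a₁, D₁, i₁⟩ := d₁ hu
      obtain ⟨a₂, D₂, i₂⟩ := d₂ hu
      simp only [Prod.smul_mk, Prod.mk_add_mk, smul_eq_mul]
      refine ⟨α * a₁ + β * a₂, e ▸ (D₁.smul hα).add (D₂.smul hβ), ?_⟩
      have j₁ := mul_lt_mul_of_pos_left i₁ hα
      have j₂ := mul_lt_mul_of_pos_left i₂ hβ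
      have : -ε = α * -ε + β * -ε := by rw [← add_mul, hαβ, one_mul]
      rw [this]
      linarith
  · intro u
    by_cases hu : (ψ u).toReal + (Φ u).toReal = s
    · obtain ⟨z, hz⟩ := hslope u u.2 (by rw [hI.energy_eq_coe (hdom u u.2), hu])
      obtain ⟨l, y, b, a, hl, h1, h2, h3, h4⟩ := hI.exists_descent (hdom u u.2) hz
      refine ⟨(l, y, b), ?_⟩
      have hc : Continuous fun w : A => ((w : X), y - l • (w : X)) := by fun_prop
      have ev1 : ∀ᶠ w : A in 𝓝 u, ‖y - l • (w : X)‖ < 2 :=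
        ContinuousAt.eventually_lt (by fun_prop) continuousAt_const h2
      have ev2 : ∀ᶠ w : A in 𝓝 u, a + b - l * (ψ w).toReal < -ε :=
        ContinuousAt.eventually_lt (continuous_const.sub (continuous_const.mul hψ)).continuousAt
          continuousAt_const h4
      filter_upwards [ev1, ev2, hc.continuousAt.eventually h3.eventually] with w w1 w2 w3
      exact ⟨hl, h1, w1, fun _ => ⟨a, w3, w2⟩⟩
    -- Below the top level no descent is needed: this choice has zero displacement at `u`, and
    -- nearby points stay off the top level.
    · refine ⟨(1, (u : X), (ψ u).toReal), ?_⟩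
      have ev1 : ∀ᶠ w : A in 𝓝 u, ‖(u : X) - (1 : ℝ) • (w : X)‖ < 2 :=
        ContinuousAt.eventually_lt (by fun_prop) continuousAt_const (by simp)
      have ev2 : ∀ᶠ w : A in 𝓝 u, (ψ w).toReal + (Φ w).toReal ≠ s :=
        (hψ.add hΦ).continuousAt.eventually_ne hu
      filter_upwards [ev1, ev2] with w w1 w2
      refine ⟨one_pos, ?_, w1, fun h => absurd h w2⟩
      simp [hI.coe_psi (hdom u u.2).1]

/-- A compact set on which the slope is at least `ε` at the top level can be deformed so that the
supremum of the energy decreases at rate `ε`. -/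
theorem StructuralAssumption.exists_deformation (hI : StructuralAssumption ψ Φ) {A : Set X}
    (hA : IsCompact A) (hne : A.Nonempty) {s ε : ℝ} (hs : ∀ u ∈ A, energy ψ Φ u ≤ s)
    (hslope : ∀ u ∈ A, energy ψ Φ u = s →
      ∃ z, genDeriv Φ u (z - u) + ψ z - ψ u < ((-(ε * ‖z - u‖) : ℝ) : EReal)) :
    ∃ (t : ℝ) (B : Set X), 0 < t ∧ IsCompact B ∧ B.Nonempty ∧ B ⊆ effDomain Φ ∧
      relCat A (effDomain Φ) ≤ relCat B (effDomain Φ) ∧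
      (∀ x ∈ B, energy ψ Φ x ≤ ((s - ε * t : ℝ) : EReal)) ∧
      (∀ x ∈ A, ∃ y ∈ B, dist x y ≤ 2 * t) ∧ (∀ y ∈ B, ∃ x ∈ A, dist y x ≤ 2 * t) := by
  have hdom : ∀ u ∈ A, u ∈ effDomain ψ ∩ effDomain Φ := fun u hu =>
    hI.mem_domain_of_energy_lt_top ((hs u hu).trans_lt (EReal.coe_lt_top s))
  have hsr : ∀ u ∈ A, (ψ u).toReal + (Φ u).toReal ≤ s := fun u hu => by
    have := hs u hu
    rwa [hI.energy_eq_coe (hdom u hu), EReal.coe_le_coe_iff] at this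
  have hψ := continuousOn_iff_continuous_domRestrict.1 (hI.continuousOn_psi hA hne hs)
  have hΦ := continuousOn_iff_continuous_domRestrict.1
    (hI.continuousOn_phi.mono fun u hu => (hdom u hu).2)
  obtain ⟨g, hg⟩ := hI.exists_continuous_descent hA hne hs hslope
  have hgc := g.continuous
  let v : A → X := fun u => (g u).2.1 - (g u).1 • (u : X)
  have hv : Continuous v := by fun_prop
  let f : ℝ × A → X := fun p => (p.2 : X) + p.1 • v p.2
  have hf : Continuous f := by fun_prop
  have hf0 : ∀ u, f (0, u) = u := fun u => by simp [f]
  have hfD : ∀ u : A, ∀ᶠ p in 𝓝 ((0 : ℝ), u), f p ∈ effDomain Φ := fun u =>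
    hf.continuousAt.eventually (hI.isOpen_domain.mem_nhds (by rw [hf0]; exact (hdom u u.2).2))
  -- `f (t, u)` is the convex combination of `u` and the target with weight `t * l` on the target,
  -- so convexity bounds ψ there.
  have hbound : ∀ (u : A) (t : ℝ), 0 < t → t * (g u).1 < 1 → f (t, u) ∈ effDomain Φ →
      energy ψ Φ (f (t, u)) ≤ (((1 - t * (g u).1) * (ψ u).toReal + t * (g u).2.2 +
        (Φ (f (t, u))).toReal : ℝ) : EReal) := by
    intro u t ht htl hfd
    obtain ⟨hl, hψl, -, -⟩ := hg u
    have e : f (t, u) = (1 - t * (g u).1) • (u : X) +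
        (t * (g u).1) • ((g u).1⁻¹ • (g u).2.1) := by
      simp only [f, v, smul_smul]
      rw [mul_assoc, mul_inv_cancel₀ hl.ne', mul_one]
      module
    have h1 : ψ (f (t, u)) ≤
        (((1 - t * (g u).1) * (ψ u).toReal + t * (g u).2.2 : ℝ) : EReal) := by
      rw [e]
      refine (hI.psi_convex _ _ _ _ (by linarith) (by positivity) (by ring)).trans ?_
      rw [← hI.coe_psi (hdom u u.2).1]
      refine (add_le_add_right (mul_le_mul_of_nonneg_left hψl ?_) _).trans ?_
      · exact_mod_cast (by positivity : 0 ≤ t * (g u).1)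
      · norm_cast
        refine le_of_eq ?_
        field_simp
        rw [EReal.toReal_coe]
    rw [energy, EReal.coe_add, hI.coe_phi hfd]
    exact add_le_add_left h1 _
  have hloc : ∀ u : A, ∀ᶠ p in 𝓝 ((0 : ℝ), u), 0 < p.1 →
      energy ψ Φ (f p) ≤ ((s - ε * p.1 : ℝ) : EReal) := by
    intro u
    have hev1 : ∀ᶠ p : ℝ × A in 𝓝 ((0 : ℝ), u), p.1 * (g p.2).1 < 1 :=
      ContinuousAt.eventually_lt (by fun_prop) continuousAt_const (by simp)
    by_cases hu : (ψ u).toReal + (Φ u).toReal = s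
    · obtain ⟨a, hD, ha⟩ := (hg u).2.2.2 hu
      have hev2 : ∀ᶠ p : ℝ × A in 𝓝 ((0 : ℝ), u), 0 < p.1 →
          (Φ (f p)).toReal - (Φ p.2).toReal ≤ p.1 * a := by
        have ht : Tendsto (fun p : ℝ × A => ((p.2 : X), p.1, v p.2)) (𝓝[>] 0 ×ˢ 𝓝 u)
            (𝓝 (u : X) ×ˢ 𝓝[>] (0 : ℝ) ×ˢ 𝓝 (v u)) :=
          ((continuous_subtype_val.tendsto u).comp tendsto_snd).prodMk
            (tendsto_fst.prodMk ((hv.tendsto u).comp tendsto_snd))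
        have := ht.eventually hD
        rw [← nhdsWithin_univ u, ← nhdsWithin_prod_eq, eventually_nhdsWithin_iff] at this
        filter_upwards [this] with p hp hp0
        exact hp ⟨hp0, mem_univ _⟩
      have hev3 : ∀ᶠ p : ℝ × A in 𝓝 ((0 : ℝ), u),
          a + (g p.2).2.2 - (g p.2).1 * (ψ p.2).toReal < -ε := by
        refine ContinuousAt.eventually_lt ?_ continuousAt_const ha
        exact (Continuous.sub (by fun_prop)
          ((by fun_prop : Continuous fun p : ℝ × A => (g p.2).1).mul
            (hψ.comp continuous_snd))).continuousAt
      filter_upwards [hev1, hev2, hev3, hfD u] with p h1 h2 h3 h4 hp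
      refine (hbound p.2 p.1 hp h1 h4).trans (EReal.coe_le_coe_iff.2 ?_)
      have h5 := h2 hp
      have h6 := mul_lt_mul_of_pos_left h3 hp
      have h7 := hsr p.2 p.2.2
      have h8 : f (p.1, p.2) = f p := rfl
      rw [h8]
      linarith
    · have hlt : (ψ u).toReal + (Φ u).toReal < s := lt_of_le_of_ne (hsr u u.2) hu
      have hev2 : ∀ᶠ p : ℝ × A in 𝓝 ((0 : ℝ), u),
          (1 - p.1 * (g p.2).1) * (ψ p.2).toReal + p.1 * (g p.2).2.2 + (Φ (f p)).toReal <
            s - ε * p.1 := by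
        refine ContinuousAt.eventually_lt (ContinuousAt.add ?_ ?_) (by fun_prop) ?_
        · exact (Continuous.add ((by fun_prop : Continuous fun p : ℝ × A =>
            1 - p.1 * (g p.2).1).mul (hψ.comp continuous_snd)) (by fun_prop)).continuousAt
        · have hc : ContinuousAt (fun x => (Φ x).toReal) (f (0, u)) := by
            rw [hf0]
            exact hI.continuousOn_phi.continuousAt (hI.isOpen_domain.mem_nhds (hdom u u.2).2)
          exact ContinuousAt.comp (f := f) (x := (0, u)) hc hf.continuousAt
        · simpa [hf0] using hlt
      filter_upwards [hev1, hev2, hfD u] with p h1 h2 h4 hp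
      exact (hbound p.2 p.1 hp h1 h4).trans (EReal.coe_le_coe_iff.2 h2.le)
  have : CompactSpace A := isCompact_iff_compactSpace.1 hA
  -- Compactness of `A` makes the admissible times uniform in `u`.
  have hall : ∀ᶠ t : ℝ in 𝓝 0, ∀ u : A, f (t, u) ∈ effDomain Φ ∧
      (0 < t → energy ψ Φ (f (t, u)) ≤ ((s - ε * t : ℝ) : EReal)) := by
    have := isCompact_univ.eventually_forall_of_forall_eventually (x₀ := (0 : ℝ))
      (P := fun t (u : A) => f (t, u) ∈ effDomain Φ ∧
        (0 < t → energy ψ Φ (f (t, u)) ≤ ((s - ε * t : ℝ) : EReal)))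
      fun u _ => (hfD u).and (hloc u)
    filter_upwards [this] with t ht u using ht u (mem_univ u)
  obtain ⟨δ, hδ, hδs⟩ := Metric.eventually_nhds_iff.1 hall
  have hpos : 0 < δ / 2 := half_pos hδ
  have hin : ∀ t : ℝ, 0 ≤ t → t ≤ δ / 2 → dist t 0 < δ := fun t h0 h1 => by
    rw [Real.dist_eq, sub_zero, abs_of_nonneg h0]; linarith
  have hdist : ∀ u : A, dist (f (δ / 2, u)) u ≤ 2 * (δ / 2) := fun u => by
    simp only [f, dist_eq_norm, add_sub_cancel_left, norm_smul, Real.norm_of_nonneg hpos.le]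
    have := (hg u).2.2.1
    have h2 : ‖v u‖ < 2 := this
    nlinarith
  have hmem := fun u => hδs (hin (δ / 2) hpos.le le_rfl) u
  refine ⟨δ / 2, range fun u : A => f (δ / 2, u), hpos, isCompact_range (by fun_prop), ?_, ?_, ?_,
    ?_, ?_, ?_⟩
  · obtain ⟨u, hu⟩ := hne
    exact ⟨_, ⟨u, hu⟩, rfl⟩
  · rintro _ ⟨u, rfl⟩
    exact (hmem u).1
  · refine relCat_le_of_homotopic hA.isClosed (fun u hu => (hdom u hu).2)
      ⟨fun u => ⟨f (δ / 2, u), (hmem u).1⟩, by fun_prop⟩ ?_ fun u => mem_range_self u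
    have hM : ∀ p : unitInterval × A, f ((p.1 : ℝ) * (δ / 2), p.2) ∈ effDomain Φ := fun p =>
      (hδs (hin _ (mul_nonneg p.1.2.1 hpos.le)
        (mul_le_of_le_one_left hpos.le p.1.2.2)) p.2).1
    refine ⟨⟨⟨fun p => ⟨f ((p.1 : ℝ) * (δ / 2), p.2), hM p⟩, by fun_prop⟩, ?_, ?_⟩⟩
    · intro u
      simp [hf0]
    · intro u
      simp
  · rintro _ ⟨u, rfl⟩
    exact (hmem u).2 hpos
  · intro u hu
    exact ⟨_, ⟨⟨u, hu⟩, rfl⟩, dist_comm u (f (δ / 2, ⟨u, hu⟩)) ▸ hdist ⟨u, hu⟩⟩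
  · rintro _ ⟨u, rfl⟩
    exact ⟨u, u.2, hdist u⟩

end Deformation

/-! ### Min-max levels and the Ekeland argument on compact sets -/

open TopologicalSpace (NonemptyCompacts)

theorem NonemptyCompacts.exists_dist_le {X : Type*} [MetricSpace X] (A B : NonemptyCompacts X)
    {x : X} (hx : x ∈ A) : ∃ y ∈ B, dist x y ≤ dist A B := by
  obtain ⟨y, hy, hxy⟩ := B.isCompact.exists_infDist_eq_dist B.nonempty x
  refine ⟨y, hy, hxy ▸ Metric.infDist_le_hausdorffDist_of_mem hx ?_⟩
  exact Metric.hausdorffEDist_ne_top_of_nonempty_of_bounded A.nonempty B.nonempty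
    A.isCompact.isBounded B.isCompact.isBounded

theorem minMaxLevel_mono {X : Type*} [TopologicalSpace X] (ψ Φ : X → EReal) :
    Monotone (minMaxLevel ψ Φ) := fun _ _ h =>
  biInf_mono fun _ hA => ⟨hA.1, hA.2.1, le_trans (by exact_mod_cast h) hA.2.2⟩

theorem minMaxLevel_zero {X : Type*} [TopologicalSpace X] (ψ Φ : X → EReal) :
    minMaxLevel ψ Φ 0 = ⊥ :=
  le_bot_iff.1 <| (iInf₂_le (∅ : Set X) ⟨empty_subset _, isCompact_empty, by simp⟩).trans
    (by simp)

section

variable {X Y : Type*} [NormedAddCommGroup X] [NormedSpace ℝ X]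
    [NormedAddCommGroup Y] [NormedSpace ℝ Y] {ι : X →L[ℝ] Y} {ψ Φ : X → EReal}

/-- Under the weak Palais–Smale condition, the slope is bounded below near the level `c`, away from
the critical points at that level. -/
theorem WeakPS.exists_slope_bound {c : ℝ} (hPS : WeakPS ι ψ Φ c) {r : ℝ} (hr : 0 < r) :
    ∃ ε : ℝ, 0 < ε ∧ ∀ u ∈ effDomain ψ ∩ effDomain Φ, (c : EReal) ≤ energy ψ Φ u →
      energy ψ Φ u ≤ ((c + ε : ℝ) : EReal) →
      (∀ x, IsCriticalPoint ψ Φ x → energy ψ Φ x = c → r ≤ ‖ι u - ι x‖) →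
      ∃ z, genDeriv Φ u (z - u) + ψ z - ψ u < ((-(ε * ‖z - u‖) : ℝ) : EReal) := by
  -- Failure for every `ε = 1 / (n + 1)` produces a Palais–Smale sequence whose Y-limit is a
  -- critical point it should stay away from.
  by_contra! hcon
  choose u hu h1 h2 h3 h4 using fun n : ℕ => hcon (1 / ((n : ℝ) + 1)) Nat.one_div_pos_of_nat
  have hlim := tendsto_one_div_add_atTop_nhds_zero_nat (𝕜 := ℝ)
  have hlevel : Tendsto (fun n => energy ψ Φ (u n)) atTop (𝓝 (c : EReal)) := by
    refine tendsto_of_tendsto_of_tendsto_of_le_of_le tendsto_const_nhds ?_ h1 h2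
    refine (continuous_coe_real_ereal.tendsto c).comp ?_
    simpa using hlim.const_add c
  obtain ⟨y, k, -, hy, hyc, hlim'⟩ :=
    hPS u ⟨hu, hlevel, _, fun n => Nat.one_div_pos_of_nat, hlim, h4⟩
  have h5 : ∀ᶠ n in atTop, ‖ι (u (k n)) - ι y‖ < r := by
    simpa [dist_eq_norm] using (Metric.tendsto_nhds.1 hlim') r hr
  obtain ⟨n, hn⟩ := h5.exists
  exact absurd (h3 (k n) y hy hyc) (not_le.2 hn)

/-- A limit outside the open set D_Φ would lie on its frontier, where I blows up. Inside, Φ is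
continuous and ψ lower semicontinuous. -/
theorem StructuralAssumption.mem_and_energy_le_of_tendsto (hI : StructuralAssumption ψ Φ)
    {x : ℕ → X} {a : X} {q : ℝ} (hx : Tendsto x atTop (𝓝 a))
    (hq : ∀ n, energy ψ Φ (x n) ≤ (q : EReal)) : a ∈ effDomain Φ ∧ energy ψ Φ a ≤ q := by
  have hdom : ∀ n, x n ∈ effDomain ψ ∩ effDomain Φ := fun n =>
    hI.mem_domain_of_energy_lt_top ((hq n).trans_lt (EReal.coe_lt_top q))
  have ha : a ∈ effDomain Φ := by
    by_contra ha
    have hfr : a ∈ frontier (effDomain Φ) := by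
      rw [hI.isOpen_domain.frontier_eq]
      exact ⟨mem_closure_of_tendsto hx (Eventually.of_forall fun n => (hdom n).2), ha⟩
    have h0 : Tendsto (fun n => Metric.infEDist (x n) (frontier (effDomain Φ))) atTop (𝓝 0) :=
      tendsto_of_tendsto_of_tendsto_of_le_of_le tendsto_const_nhds
        (tendsto_iff_edist_tendsto_0.1 hx) (fun _ => zero_le)
        fun n => Metric.infEDist_le_edist_of_mem hfr
    obtain ⟨n, hn⟩ := ((hI.blow_up x hdom h0).eventually (lt_mem_nhds (EReal.coe_lt_top q))).exists
    exact absurd (hq n) (not_le.2 hn)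
  refine ⟨ha, ?_⟩
  have hΦ : Tendsto (fun n => (Φ (x n)).toReal) atTop (𝓝 (Φ a).toReal) :=
    (hI.continuousOn_phi.continuousAt (hI.isOpen_domain.mem_nhds ha)).tendsto.comp hx
  have hψ : ψ a ≤ ((q - (Φ a).toReal : ℝ) : EReal) := by
    refine le_of_forall_lt fun b hb => ?_
    obtain ⟨b', hb1, hb2⟩ := exists_between hb
    refine hb1.trans_le (le_of_tendsto_of_tendsto (tendsto_const_nhds (x := b'))
      ((continuous_coe_real_ereal.tendsto _).comp (hΦ.const_sub q)) ?_)
    filter_upwards [hx.eventually (hI.psi_lsc a b' hb2)] with n hn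
    refine hn.le.trans ?_
    have := hq n
    rw [hI.energy_eq_coe (hdom n), EReal.coe_le_coe_iff] at this
    rw [← hI.coe_psi (hdom n).1]
    exact EReal.coe_le_coe_iff.2 (by linarith)
  rw [energy, ← hI.coe_phi ha]
  refine (add_le_add_left hψ _).trans ?_
  rw [← EReal.coe_add, sub_add_cancel]

/-- Approximating sets eventually lie in a thickening of the limit `B` whose category is at most
that of `B`, so the lower bound on the category survives. -/
theorem StructuralAssumption.isClosed_minMaxFamily_sublevel (hI : StructuralAssumption ψ Φ)
    (j : ℕ) (q : ℝ) : IsClosed {A : NonemptyCompacts X |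
      (A : Set X) ∈ minMaxFamily Φ j ∧ ∀ x ∈ A, energy ψ Φ x ≤ (q : EReal)} := by
  refine IsSeqClosed.isClosed fun A B hA hlim => ?_
  have hd : Tendsto (fun n => dist B (A n)) atTop (𝓝 0) := by
    simpa [dist_comm] using tendsto_iff_dist_tendsto_zero.1 hlim
  have hB : ∀ b ∈ B, b ∈ effDomain Φ ∧ energy ψ Φ b ≤ q := by
    intro b hb
    choose x hx hxd using fun n => NonemptyCompacts.exists_dist_le B (A n) hb
    refine hI.mem_and_energy_le_of_tendsto (x := x) ?_ fun n => (hA n).2 _ (hx n)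
    rw [tendsto_iff_dist_tendsto_zero]
    exact squeeze_zero (fun _ => dist_nonneg) (fun n => by rw [dist_comm]; exact hxd n) hd
  refine ⟨⟨fun b hb => (hB b hb).1, B.isCompact, ?_⟩, fun b hb => (hB b hb).2⟩
  obtain ⟨δ, hδ, hcat⟩ := exists_relCat_thickening_le hI.isOpen_domain B.isCompact
  obtain ⟨n, hn⟩ := (hd.eventually (gt_mem_nhds hδ)).exists
  refine (hA n).1.2.2.trans ((relCat_mono fun x hx => ?_).trans hcat)
  obtain ⟨y, hy, hxy⟩ := NonemptyCompacts.exists_dist_le (A n) B hx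
  exact Metric.mem_thickening_iff.2 ⟨y, hy, hxy.trans_lt (by rwa [dist_comm])⟩

/-- If `c_j = c_{j+m} = c`, then a set of category at most `m` does not contain a uniform
neighbourhood, for the norm of `Y`, of the critical points at level `c`. -/
theorem StructuralAssumption.not_subset_of_minMaxLevel_eq [CompleteSpace X]
    (hI : StructuralAssumption ψ Φ) {c : ℝ} (hPS : WeakPS ι ψ Φ c) {j m : ℕ}
    (hj : minMaxLevel ψ Φ j = c) (hjm : minMaxLevel ψ Φ (j + m) = c) {r : ℝ} (hr : 0 < r)
    {N : Set X} (hN : relCat N (effDomain Φ) ≤ m)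
    (hKN : ∀ x, IsCriticalPoint ψ Φ x → energy ψ Φ x = c → {u | ‖ι u - ι x‖ < r} ⊆ N) :
    False := by
  obtain ⟨ε, hε, hslope⟩ := hPS.exists_slope_bound (half_pos hr)
  -- A deformation of time `t` gains `ε * t` and moves the set by at most `2 * t`; the Ekeland price
  -- `2 * κ * t` is half the gain.
  obtain ⟨κ, hκ, hκε⟩ : ∃ κ : ℝ, 0 < κ ∧ 4 * κ = ε := ⟨ε / 4, by positivity, by ring⟩
  -- Ekeland moves the set by at most `η / κ`, hence by at most `r / 2` in the norm of Y.
  obtain ⟨η, hη, hηε, hηr⟩ : ∃ η : ℝ, 0 < η ∧ η ≤ ε ∧ ‖ι‖ * (η / κ) ≤ r / 2 := by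
    refine ⟨min ε (κ * (r / 2) / (‖ι‖ + 1)), by positivity, min_le_left _ _, ?_⟩
    have h1 : min ε (κ * (r / 2) / (‖ι‖ + 1)) ≤ κ * (r / 2) / (‖ι‖ + 1) := min_le_right _ _
    calc ‖ι‖ * (min ε (κ * (r / 2) / (‖ι‖ + 1)) / κ)
        ≤ (‖ι‖ + 1) * ((κ * (r / 2) / (‖ι‖ + 1)) / κ) := by gcongr; linarith
      _ = r / 2 := by field_simp
  obtain ⟨A, hA, hAc⟩ : ∃ A ∈ minMaxFamily Φ (j + m),
      ⨆ x ∈ A, energy ψ Φ x < ((c + η : ℝ) : EReal) := by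
    have : minMaxLevel ψ Φ (j + m) < ((c + η : ℝ) : EReal) := by
      rw [hjm]; exact_mod_cast lt_add_of_pos_right c hη
    simpa [minMaxLevel, iInf_lt_iff] using this
  have hle : ∀ x ∈ A, energy ψ Φ x ≤ ((c + η : ℝ) : EReal) := fun x hx =>
    (le_iSup₂ (f := fun x (_ : x ∈ A) => energy ψ Φ x) x hx).trans hAc.le
  let U : Set X := {u | ∃ x, IsCriticalPoint ψ Φ x ∧ energy ψ Φ x = c ∧ ‖ι u - ι x‖ < r}
  have hU : IsOpen U := by
    have : U = ⋃ x ∈ {x | IsCriticalPoint ψ Φ x ∧ energy ψ Φ x = c}, {u | ‖ι u - ι x‖ < r} := by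
      ext u; simp [U, and_assoc]
    rw [this]
    exact isOpen_biUnion fun x _ => isOpen_lt (by fun_prop) continuous_const
  have hBcat : (j : ℕ∞) ≤ relCat (A \ U) (effDomain Φ) := by
    have h1 : A ⊆ (A \ U) ∪ N := fun x hx => by
      by_cases hxU : x ∈ U
      · obtain ⟨y, hy, hyc, hxy⟩ := hxU
        exact Or.inr (hKN y hy hyc hxy)
      · exact Or.inl ⟨hx, hxU⟩
    have h2 := hA.2.2.trans ((relCat_mono h1).trans relCat_union_le)
    have h3 : (j : ℕ∞) + m ≤ relCat (A \ U) (effDomain Φ) + m := by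
      refine le_trans ?_ (h2.trans (add_le_add_right hN _))
      exact_mod_cast le_rfl
    exact (ENat.add_le_add_iff_right (ENat.natCast_ne_top m)).1 h3
  -- The empty set belongs to 𝓕_0, so c_0 = ⊥. With `j` positive, `A \ U` is nonempty.
  have hj0 : j ≠ 0 := by
    rintro rfl
    rw [minMaxLevel_zero] at hj
    exact EReal.bot_ne_coe c hj
  have hBne : (A \ U).Nonempty := by
    by_contra hne
    rw [not_nonempty_iff_eq_empty.1 hne, relCat_empty] at hBcat
    exact hj0 (by exact_mod_cast le_zero_iff.1 hBcat)
  let B : NonemptyCompacts X := ⟨⟨A \ U, hA.2.1.diff hU⟩, hBne⟩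
  let S : Set (NonemptyCompacts X) := {C | (C : Set X) ∈ minMaxFamily Φ j ∧
    ∀ x ∈ C, energy ψ Φ x ≤ ((c + ε : ℝ) : EReal)}
  let f : NonemptyCompacts X → ℝ := fun C => (⨆ x ∈ C, energy ψ Φ x).toReal
  have hcle : ∀ C ∈ S, (c : EReal) ≤ ⨆ x ∈ C, energy ψ Φ x := fun C hC =>
    hj ▸ iInf₂_le (C : Set X) hC.1
  have hf : ∀ C ∈ S, ((f C : ℝ) : EReal) = ⨆ x ∈ C, energy ψ Φ x := fun C hC =>
    EReal.coe_toReal ((iSup₂_le hC.2).trans_lt (EReal.coe_lt_top _)).ne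
      ((EReal.bot_lt_coe c).trans_le (hcle C hC)).ne'
  have hfle : ∀ C ∈ S, ∀ q : ℝ, f C ≤ q ↔ ∀ x ∈ C, energy ψ Φ x ≤ (q : EReal) := fun C hC q => by
    rw [← EReal.coe_le_coe_iff, hf C hC, iSup₂_le_iff]
  have hfc : ∀ C ∈ S, c ≤ f C := fun C hC => by
    rw [← EReal.coe_le_coe_iff, hf C hC]; exact hcle C hC
  have hBS : B ∈ S := ⟨⟨sdiff_subset.trans hA.1, B.isCompact, hBcat⟩, fun x hx =>
    (hle x hx.1).trans (EReal.coe_le_coe_iff.2 (by linarith))⟩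
  have hfB : f B ≤ c + η := (hfle B hBS _).2 fun x hx => hle x hx.1
  have hSq : ∀ q : ℝ, IsClosed {C | C ∈ S ∧ f C ≤ q} := fun q => by
    have : {C | C ∈ S ∧ f C ≤ q} = {C : NonemptyCompacts X | (C : Set X) ∈ minMaxFamily Φ j ∧
        ∀ x ∈ C, energy ψ Φ x ≤ ((min q (c + ε) : ℝ) : EReal)} := by
      ext C
      constructor
      · rintro ⟨hC, hq⟩
        exact ⟨hC.1, (hfle C hC _).1 (le_min hq ((hfle C hC _).2 hC.2))⟩
      · rintro ⟨hC, hq⟩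
        have hC' : C ∈ S := ⟨hC, fun x hx =>
          (hq x hx).trans (EReal.coe_le_coe_iff.2 (min_le_right _ _))⟩
        exact ⟨hC', (hfle C hC' _).2 fun x hx =>
          (hq x hx).trans (EReal.coe_le_coe_iff.2 (min_le_left _ _))⟩
    rw [this]
    exact hI.isClosed_minMaxFamily_sublevel j _
  obtain ⟨C, hCS, hCB, hCmin⟩ := exists_ekeland_point hfc hSq hκ hBS
  have hdCB : dist C B ≤ η / κ := by
    rw [le_div_iff₀ hκ]
    have := hfc C hCS
    linarith
  obtain ⟨t, E, ht, hEc, hEne, hED, hEcat, hEle, hCE, hEC⟩ := hI.exists_deformation C.isCompact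
    C.nonempty (s := f C) (ε := ε) ((hfle C hCS _).1 le_rfl) fun u hu hus => by
      refine hslope u (hI.mem_domain_of_energy_lt_top (hus ▸ EReal.coe_lt_top _)) ?_ (hCS.2 u hu) ?_
      · rw [hus]
        exact EReal.coe_le_coe_iff.2 (hfc C hCS)
      · intro x hx hxc
        obtain ⟨y, hy, huy⟩ := NonemptyCompacts.exists_dist_le C B hu
        have h1 : r ≤ ‖ι y - ι x‖ := not_lt.1 fun h => hy.2 ⟨x, hx, hxc, h⟩
        have h2 : ‖ι y - ι u‖ ≤ r / 2 := by
          rw [← map_sub]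
          refine (ι.le_opNorm _).trans ((mul_le_mul_of_nonneg_left ?_ (norm_nonneg _)).trans hηr)
          rw [← dist_eq_norm, dist_comm]
          exact huy.trans hdCB
        have h3 := norm_sub_le_norm_sub_add_norm_sub (ι y) (ι u) (ι x)
        linarith
  let F : NonemptyCompacts X := ⟨⟨E, hEc⟩, hEne⟩
  have hfCε : f C ≤ c + ε := (hfle C hCS _).2 hCS.2
  have hεt : 0 < ε * t := mul_pos hε ht
  have hFS : F ∈ S := ⟨⟨hED, hEc, hCS.1.2.2.trans hEcat⟩, fun x hx =>
    (hEle x hx).trans (EReal.coe_le_coe_iff.2 (by linarith))⟩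
  have hfF : f F ≤ f C - ε * t := (hfle F hFS _).2 hEle
  have hdist : dist F C ≤ 2 * t := Metric.hausdorffDist_le_of_mem_dist (by positivity) hEC hCE
  have hlt := hCmin F hFS fun h => by rw [h] at hfF; linarith
  have := mul_le_mul_of_nonneg_left hdist hκ.le
  rw [← hκε] at hfF hεt
  nlinarith

end

/-! ### Neighbourhoods of finite sets in the norm of Y -/

/-- Every map from a discrete space to a path-connected space is nullhomotopic. -/
theorem nullhomotopic_of_discreteTopology {K M : Type*} [TopologicalSpace K] [DiscreteTopology K]
    [TopologicalSpace M] [PathConnectedSpace M] (k : C(K, M)) : k.Nullhomotopic := by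
  obtain ⟨m⟩ := PathConnectedSpace.nonempty (X := M)
  let γ : ∀ x, Path (k x) m := fun x => PathConnectedSpace.somePath _ _
  refine ⟨m, ⟨⟨⟨fun p => γ p.2 p.1, ?_⟩, fun x => (γ x).source, fun x => (γ x).target⟩⟩⟩
  exact continuous_prod_of_discrete_right.2 fun x => (γ x).continuous

section

variable {X Y : Type*} [NormedAddCommGroup X] [NormedSpace ℝ X]
    [NormedAddCommGroup Y] [NormedSpace ℝ Y] (ι : X →L[ℝ] Y) {D : Set X} {r : ℝ}

theorem segment_subset_of_norm_map_sub_le {x u : X} (hr : 0 ≤ r)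
    (h : {u | ‖ι u - ι x‖ ≤ r} ⊆ D) (hu : ‖ι u - ι x‖ ≤ r) : segment ℝ u x ⊆ D := by
  have hc : Convex ℝ (ι ⁻¹' Metric.closedBall (ι x) r) :=
    (convex_closedBall (ι x) r).linear_preimage ι.toLinearMap
  refine Subset.trans (hc.segment_subset ?_ ?_) fun v hv => h ?_
  · simpa [dist_eq_norm] using hu
  · simpa using hr
  · simpa [dist_eq_norm] using hv

theorem relCat_biUnion_le {K : Set X} (hK : K.Finite) (hr : 0 ≤ r)
    (h : ∀ x ∈ K, {u | ‖ι u - ι x‖ ≤ r} ⊆ D) :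
    relCat (⋃ x ∈ K, {u | ‖ι u - ι x‖ ≤ r}) D ≤ K.ncard := by
  have := hK.fintype
  rw [← Nat.card_coe_set_eq, Nat.card_eq_fintype_card]
  let e := Fintype.equivFin K
  refine relCat_le_of_cover (fun i => {u | ‖ι u - ι (e.symm i)‖ ≤ r}) (fun i => ⟨?_, ?_⟩) ?_
  · exact isClosed_le (by fun_prop) continuous_const
  · have hx := h _ (e.symm i).2
    exact contractibleIn_of_segment_subset ⟨e.symm i, hx (by simpa using hr)⟩ fun u hu =>
      segment_subset_of_norm_map_sub_le ι hr hx hu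
  · refine iUnion₂_subset fun x hx => subset_iUnion_of_subset (e ⟨x, hx⟩) ?_
    simp

/-- The balls are separated, so sending a point to the centre of its ball is continuous and, by
convexity of the balls, homotopic to the inclusion. The finite set of centres then contracts along
paths in `D`. -/
theorem contractibleIn_biUnion {K : Set X} (hK : K.Finite) (hr : 0 < r)
    (hD : IsPathConnected D) (h : ∀ x ∈ K, {u | ‖ι u - ι x‖ ≤ r} ⊆ D)
    (hsep : ∀ x ∈ K, ∀ y ∈ K, x ≠ y → 3 * r ≤ ‖ι x - ι y‖) :
    ContractibleIn (⋃ x ∈ K, {u | ‖ι u - ι x‖ ≤ r}) D := by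
  have := isPathConnected_iff_pathConnectedSpace.1 hD
  have := hK.to_subtype
  have hmem : ∀ u : ↥(⋃ x ∈ K, {u | ‖ι u - ι x‖ ≤ r}), ∃ x : K, ‖ι u - ι x‖ ≤ r := by
    rintro ⟨u, hu⟩
    obtain ⟨x, hx, hux⟩ := mem_iUnion₂.1 hu
    exact ⟨⟨x, hx⟩, hux⟩
  choose p hp using hmem
  have hloc : IsLocallyConstant p := by
    rw [IsLocallyConstant.iff_eventually_eq]
    intro u
    have : ∀ᶠ v : ↥(⋃ x ∈ K, {u | ‖ι u - ι x‖ ≤ r}) in 𝓝 u, ‖ι (v : X) - ι u‖ < r :=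
      ContinuousAt.eventually_lt (by fun_prop) continuousAt_const (by simpa using hr)
    filter_upwards [this] with v hv
    -- Two different centres would be at distance less than `r + r + r`.
    by_contra hne
    have h1 := hsep (p v) (p v).2 (p u) (p u).2 (fun h => hne (Subtype.ext h))
    have h2 := norm_sub_le_norm_sub_add_norm_sub (ι (p v : X)) (ι v) (ι (p u : X))
    have h3 := norm_sub_le_norm_sub_add_norm_sub (ι (v : X)) (ι u) (ι (p u : X))
    rw [norm_sub_rev (ι (p v : X)) (ι v)] at h2
    linarith [hp u, hp v]
  let P : C(↥(⋃ x ∈ K, {u | ‖ι u - ι x‖ ≤ r}), K) := ⟨p, hloc.continuous⟩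
  let k : C(K, D) := ⟨fun x => ⟨x, h x x.2 (by simpa using hr.le)⟩, continuous_of_discreteTopology⟩
  obtain ⟨m, hm⟩ := (nullhomotopic_of_discreteTopology k).comp_left P
  exact ⟨iUnion₂_subset h, m, (homotopic_of_segment_subset _ (k.comp P) fun u =>
    segment_subset_of_norm_map_sub_le ι hr.le (h _ (p u).2) (hp u)).trans hm⟩

end

end NonsmoothMinMax

/-! ### The main theorem -/

theorem theorem2p2 {X Y : Type*}
    [NormedAddCommGroup X] [NormedSpace ℝ X] [CompleteSpace X]
    [NormedAddCommGroup Y] [NormedSpace ℝ Y] [CompleteSpace Y]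
    (ι : X →L[ℝ] Y) (hι : Function.Injective ι)
    (ψ Φ : X → EReal) (hI : StructuralAssumption ψ Φ)
    (hPS : ∀ c : ℝ, (⨅ x, energy ψ Φ x) < (c : EReal) → WeakPS ι ψ Φ c)
    (j₀ : ℕ)
    (h_nonempty : ∀ j, j₀ ≤ j → (minMaxFamily Φ j).Nonempty)
    (h_finite : ∀ j, j₀ ≤ j → minMaxLevel ψ Φ j < ⊤)
    (h_level : (⨅ x, energy ψ Φ x) < minMaxLevel ψ Φ j₀) :
    (∀ j, j₀ ≤ j → ∃ x, IsCriticalPoint ψ Φ x ∧ energy ψ Φ x = minMaxLevel ψ Φ j) ∧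
    ((∀ x, IsCriticalPoint ψ Φ x → (⨅ y, energy ψ Φ y) < energy ψ Φ x →
        ∃ r : ℝ, 0 < r ∧ {u : X | ‖ι u - ι x‖ < r} ⊆ effDomain Φ) →
      {x | IsCriticalPoint ψ Φ x}.Infinite ∧
      (IsConnected (effDomain Φ) →
        ∀ j₁ j₂ : ℕ, j₀ ≤ j₁ → j₁ < j₂ → minMaxLevel ψ Φ j₁ = minMaxLevel ψ Φ j₂ →
          {x | IsCriticalPoint ψ Φ x ∧ energy ψ Φ x = minMaxLevel ψ Φ j₁}.Infinite)) := by
  have hmono := minMaxLevel_mono ψ Φ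
  have hinf : ∀ j, j₀ ≤ j → (⨅ x, energy ψ Φ x) < minMaxLevel ψ Φ j := fun j hj =>
    h_level.trans_le (hmono hj)
  have hreal : ∀ j, j₀ ≤ j → ∃ c : ℝ, minMaxLevel ψ Φ j = c := fun j hj =>
    ⟨_, (EReal.coe_toReal (h_finite j hj).ne (bot_le.trans_lt (hinf j hj)).ne').symm⟩
  have hcrit : ∀ j, j₀ ≤ j → ∃ x, IsCriticalPoint ψ Φ x ∧ energy ψ Φ x = minMaxLevel ψ Φ j := by
    intro j hj
    by_contra! hcon
    obtain ⟨c, hc⟩ := hreal j hj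
    -- With no critical point at the level, `N = ∅` satisfies the hypothesis with `m = 0` and any
    -- radius.
    exact hI.not_subset_of_minMaxLevel_eq (hPS c (hc ▸ hinf j hj)) hc (m := 0) hc one_pos
      relCat_empty.le fun x hx hxc => absurd (hxc.trans hc.symm) (hcon x hx)
  refine ⟨hcrit, fun hnhd => ?_⟩
  have hball : ∀ j, j₀ ≤ j →
      {x | IsCriticalPoint ψ Φ x ∧ energy ψ Φ x = minMaxLevel ψ Φ j}.Finite →
      ∀ᶠ r in 𝓝[>] (0 : ℝ), ∀ x ∈ {x | IsCriticalPoint ψ Φ x ∧ energy ψ Φ x = minMaxLevel ψ Φ j},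
        {u | ‖ι u - ι x‖ ≤ r} ⊆ effDomain Φ := by
    intro j hj hfin
    refine (eventually_all_finite hfin).2 fun x hx => ?_
    obtain ⟨r, hr, hrD⟩ := hnhd x hx.1 (hx.2 ▸ hinf j hj)
    filter_upwards [mem_nhdsWithin_of_mem_nhds (Iio_mem_nhds hr)] with s hs u hu
    exact hrD ((show ‖ι u - ι x‖ ≤ s from hu).trans_lt hs)
  refine ⟨fun hfin => ?_, fun hconn j₁ j₂ hj₁ hj₁₂ heq hfin => ?_⟩
  · have := (hfin.image (energy ψ Φ)).to_subtype
    let f : ℕ → energy ψ Φ '' {x | IsCriticalPoint ψ Φ x} := fun i =>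
      ⟨minMaxLevel ψ Φ (j₀ + i), hcrit (j₀ + i) (j₀.le_add_right i)⟩
    -- Finitely many critical points have finitely many levels, so one value is shared by infinitely
    -- many c_j; by monotonicity it then persists for `m` further indices, `m` being the number of
    -- critical points at that level.
    obtain ⟨c', hc'⟩ := Finite.exists_infinite_fiber f
    have hinfinite : (f ⁻¹' {c'}).Infinite := infinite_coe_iff.1 hc'
    obtain ⟨i, hi⟩ := hinfinite.nonempty
    have hj : j₀ ≤ j₀ + i := j₀.le_add_right i
    obtain ⟨c, hc⟩ := hreal (j₀ + i) hj
    have hK : {x | IsCriticalPoint ψ Φ x ∧ energy ψ Φ x = minMaxLevel ψ Φ (j₀ + i)}.Finite :=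
      hfin.subset fun x hx => hx.1
    set m := {x | IsCriticalPoint ψ Φ x ∧ energy ψ Φ x = minMaxLevel ψ Φ (j₀ + i)}.ncard
    obtain ⟨k, hk, hik⟩ := hinfinite.exists_gt (i + m)
    have hck : minMaxLevel ψ Φ (j₀ + k) = c :=
      (congrArg Subtype.val ((hk : f k = c').trans (hi : f i = c').symm)).trans hc
    have hcm : minMaxLevel ψ Φ (j₀ + i + m) = c :=
      le_antisymm (hck ▸ hmono (by omega)) (hc ▸ hmono (by omega))
    obtain ⟨r, hrD, hr⟩ := ((hball _ hj hK).and self_mem_nhdsWithin).exists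
    have hr : 0 < r := hr
    refine hI.not_subset_of_minMaxLevel_eq (hPS c (hc ▸ hinf _ hj)) hc hcm hr
      (relCat_biUnion_le ι hK hr.le hrD) fun x hx hxc u hu => ?_
    exact mem_iUnion₂.2 ⟨x, ⟨hx, hxc.trans hc.symm⟩, (show ‖ι u - ι x‖ < r from hu).le⟩
  · obtain ⟨c, hc⟩ := hreal j₁ hj₁
    have hc' : minMaxLevel ψ Φ (j₁ + 1) = c :=
      le_antisymm ((hmono hj₁₂).trans (heq.symm.trans hc).le) (hc ▸ hmono j₁.le_succ)
    -- Injectivity of `ι` keeps distinct critical points apart in Y.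
    have hsep : ∀ᶠ r in 𝓝[>] (0 : ℝ),
        ∀ x ∈ {x | IsCriticalPoint ψ Φ x ∧ energy ψ Φ x = minMaxLevel ψ Φ j₁},
        ∀ y ∈ {x | IsCriticalPoint ψ Φ x ∧ energy ψ Φ x = minMaxLevel ψ Φ j₁}, x ≠ y →
          3 * r ≤ ‖ι x - ι y‖ := by
      refine (eventually_all_finite hfin).2 fun x _ => (eventually_all_finite hfin).2 fun y _ => ?_
      by_cases hxy : x = y
      · exact Eventually.of_forall fun _ h => absurd hxy h
      have hpos : 0 < ‖ι x - ι y‖ / 3 := by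
        have := norm_pos_iff.2 (sub_ne_zero.2 (hι.ne hxy))
        positivity
      filter_upwards [mem_nhdsWithin_of_mem_nhds (Iio_mem_nhds hpos)] with r hr _
      have : r < ‖ι x - ι y‖ / 3 := hr
      linarith
    obtain ⟨r, ⟨hrD, hrs⟩, hr⟩ := (((hball j₁ hj₁ hfin).and hsep).and self_mem_nhdsWithin).exists
    have hr : 0 < r := hr
    refine hI.not_subset_of_minMaxLevel_eq (hPS c (hc ▸ hinf j₁ hj₁)) hc hc' hr
      (relCat_le_of_cover (n := 1) (fun _ => _) (fun _ => ⟨?_, contractibleIn_biUnion ι hfin hr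
        (hI.isOpen_domain.isConnected_iff_isPathConnected.1 hconn) hrD hrs⟩)
        (subset_iUnion_of_subset 0 subset_rfl)) fun x hx hxc u hu => ?_
    · exact hfin.isClosed_biUnion fun x _ => isClosed_le (by fun_prop) continuous_const
    · exact mem_iUnion₂.2 ⟨x, ⟨hx, hxc.trans hc.symm⟩, (show ‖ι u - ι x‖ < r from hu).le⟩
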